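/- Setting. For every security parameter $\lambda\in\mathbb N$ let $d=d(\lambda)\ge 1$, let $\mathcal K_\lambda=\{0,1\}^{m(\lambda)}$ be the key space, and let $\mathcal U=\{U_k\}_{k\in\mathcal K_\lambda}\subseteq U(d)$ be a keyed family of unitaries, where $m(\lambda)$ and $\log d(\lambda)$ are polynomially bounded in $\lambda$ and $\lambda$ is polynomially bounded in $\log d(\lambda)$. The space $\mathbb C^d$ is encoded in binary in $n=\lceil\log_2 d\rceil$ qubits. A quantum polynomial-time (QPT) algorithm is a uniform family of quantum circuits (gates $H$, $T$, CNOT, Toffoli and, where allowed, oracle gates): a single classical program, given $\lambda$, $d$, $n$, $m$, writes down the circuit in $\mathrm{poly}(\lambda)$ steps. A function $f$ is negligible if $\lambda^c f(\lambda)\to 0$ for every $c$. $\mathcal U$ is a pseudorandom unitary family (PRU) if (i) some QPT algorithm without oracle maps $|k\rangle|\psi\rangle$ to $U_k|\psi\rangle$ for all $k$ and all states $|\psi\rangle$, up to an infidelity that is at most a negligible function of $\lambda$; and (ii) for every QPT oracle algorithm $\mathcal A$, $$\Big|\Pr_{k\leftarrow\mathcal K_\lambda}[\mathcal A^{U_k}(1^\lambda)=1]-\Pr_{U\leftarrow\mu}[\mathcal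 A^{U}(1^\lambda)=1]\Big|$$ is negligible, where $\mu$ is the Haar measure on $U(d)$. $\mathcal U$ is universally unforgeable if every QPT adversary wins the following game with negligible probability: a uniformly random $k$ is drawn; in the learning phase the adversary has query access to $U_k$; then it receives one copy of a Haar-random pure state $|\psi\rangle\in\mathbb C^d$ and, without further queries, outputs a forgery $\omega$, which is accepted with probability $\langle\psi|U_k^\dagger\,\omega\,U_k|\psi\rangle$. For $\delta_u:\mathbb N\to\mathbb R$, $\mathcal U$ satisfies $\delta_u$-uniqueness if there is a negligible $\epsilon$ such that for all $\lambda$ $$\Pr_{i,j\leftarrow\mathcal K_\lambda}\big[\,\|\mathcal E_{U_i}-\mathcal E_{U_j}\|_\diamond\ge\delta_u(\lambda)\;\big|\;i\ne j\,\big]\ge 1-\epsilon(\lambda),$$ where $\mathcal E_U(\rho)=U\rho U^\dagger$ and $\|\Lambda_1-\Lambda_2\|_\diamond=\max_\rho\|(\Lambda_1\otimes\mathbb I)[\rho]-(\Lambda_2\otimes\mathbb I)[\rho]\|_1$ over the density matrices $\rho$ on $\mathbb C^d\otimes\mathbb C^d$ (if $|\mathcal K_\lambda|=1$ the conditional probability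 is read as $0$). Theorem. Let $\mathcal U$ be a PRU that is also universally unforgeable. Then there is a non-negligible $\delta_u$, in the strong sense that $\delta_u(\lambda)\ge\lambda^{-c}$ for some $c\in\mathbb N$ and all sufficiently large $\lambda$, such that $\mathcal U$ satisfies $\delta_u$-uniqueness. -/

import Mathlib

open scoped ComplexOrder

noncomputable section

namespace QPR

/-! ## Asymptotics -/

/-- `f` is negligible: `l ^ c * f l → 0` for every `c`. -/
def Negligible (f : ℕ → ℝ) : Prop :=
  Asymptotics.SuperpolynomialDecay Filter.atTop (fun l : ℕ => (l : ℝ)) f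

/-- `f` is non-negligible, in the strong sense that it is bounded below by an inverse polynomial
for all sufficiently large arguments. In particular it is not `Negligible`. -/
def NonNegligible (f : ℕ → ℝ) : Prop :=
  ∃ c : ℕ, ∀ᶠ l : ℕ in Filter.atTop, ((l : ℝ) ^ c)⁻¹ ≤ f l

/-- Polynomial growth. -/
def PolyBounded (f : ℕ → ℕ) : Prop := ∃ c : ℕ, ∀ l, f l ≤ l ^ c + c

/-! ## Quantum circuits with oracle gates -/

/-- A computational basis state of countably many qubits with addresses `0, 1, 2, …`. -/
abbrev Basis := ℕ → Bool

/-- A (not necessarily normalized) pure state: a finite superposition of basis states. -/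
abbrev QState := Basis →₀ ℂ

/-- The integer stored (least significant bit first) in the qubits `a, …, a + n - 1`. -/
def readReg (s : Basis) (a n : ℕ) : ℕ := Nat.ofBits fun i : Fin n => s (a + i)

/-- The basis state `s` with the register `a, …, a + n - 1` overwritten by the integer `j`. -/
def writeReg (s : Basis) (a n j : ℕ) : Basis :=
  fun q => if a ≤ q ∧ q < a + n then j.testBit (q - a) else s q

/-- The gates `H`, `T`, `CNOT` (control, target), Toffoli (control, control, target), and an oracle
query on the block of qubits that starts at address `a`. -/
inductive Gate where
  | had (x : ℕ)
  | tgate (x : ℕ)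
  | cnot (x y : ℕ)
  | toffoli (x y z : ℕ)
  | query (a : ℕ)

/-- Relabelling of addresses. -/
def Gate.map (f : ℕ → ℕ) : Gate → Gate
  | .had x => .had (f x)
  | .tgate x => .tgate (f x)
  | .cnot x y => .cnot (f x) (f y)
  | .toffoli x y z => .toffoli (f x) (f y) (f z)
  | .query a => .query (f a)

/-- A circuit is the list of its gates, in the order of application. -/
abbrev Circuit := List Gate

/-- The circuit makes no oracle query. -/
def Circuit.QueryFree (C : Circuit) : Prop := ∀ a, Gate.query a ∉ C

/-- Number of qubits used to encode the basis vectors of `ℂ^d`, that is `⌈log₂ d⌉`. -/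
def numQubits (d : ℕ) : ℕ := Nat.clog 2 d

/-- Action of a gate on a basis state when the oracle is the `d × d` matrix `U`. The oracle acts on
a block of `⌈log₂ d⌉` qubits that encodes `ℂ^d` in binary, and trivially on the bit strings that
encode no basis vector of `ℂ^d`. A `CNOT` or Toffoli gate whose target is one of its controls does
nothing. -/
def Gate.onBasis {d : ℕ} (U : Matrix (Fin d) (Fin d) ℂ) : Gate → Basis → QState
  | .had x, s =>
      Finsupp.single (Function.update s x false) (1 / (√2 : ℂ)) +
        Finsupp.single (Function.update s x true)
          (if s x = true then -(1 / (√2 : ℂ)) else 1 / (√2 : ℂ))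
  | .tgate x, s =>
      Finsupp.single s (if s x = true then Complex.exp (Complex.I * (Real.pi / 4)) else 1)
  | .cnot x y, s =>
      Finsupp.single (if x = y then s else Function.update s y (xor (s y) (s x))) 1
  | .toffoli x y z, s =>
      Finsupp.single
        (if x = z ∨ y = z then s else Function.update s z (xor (s z) (s x && s y))) 1
  | .query a, s =>
      if h : readReg s a (numQubits d) < d then
        ∑ j : Fin d, Finsupp.single (writeReg s a (numQubits d) j)
          (U j ⟨readReg s a (numQubits d), h⟩)
      else Finsupp.single s 1

/-- Linear extension of `Gate.onBasis`. -/
def Gate.apply {d : ℕ} (U : Matrix (Fin d) (Fin d) ℂ) (g : Gate) (Ψ : QState) : QState :=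
  Ψ.sum fun s c => c • g.onBasis U s

/-- The state produced by a circuit with oracle `U` from the state `Ψ`. -/
def Circuit.run {d : ℕ} (U : Matrix (Fin d) (Fin d) ℂ) (C : Circuit) (Ψ : QState) : QState :=
  C.foldl (fun Φ g => g.apply U Φ) Ψ

/-- The basis state `s` with the vector `ψ ∈ ℂ^d` loaded into the block that starts at `a`. -/
def loadState {d : ℕ} (s : Basis) (a : ℕ) (ψ : Fin d → ℂ) : QState :=
  ∑ j : Fin d, Finsupp.single (writeReg s a (numQubits d) j) (ψ j)

/-- Probability that a measurement of qubit `q` in the computational basis gives `1`. -/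
def probOne (Ψ : QState) (q : ℕ) : ℝ := Ψ.sum fun s c => if s q = true then ‖c‖ ^ 2 else 0

open Classical in
/-- `⟨φ| ρ |φ⟩`, where `ρ` is the reduced state of `Ψ` on the block of qubits that starts at `a`
(the sum runs over the basis states `r` of all the other qubits). -/
def overlap {d : ℕ} (Ψ : QState) (a : ℕ) (φ : Fin d → ℂ) : ℝ :=
  ∑ r ∈ Ψ.support.image (fun s => writeReg s a (numQubits d) 0),
    ‖∑ j : Fin d, star (φ j) * Ψ (writeReg r a (numQubits d) j)‖ ^ 2

/-! ## Uniform polynomial time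

Uniform circuit families: one classical program, over finitely many natural number variables, writes
down the circuit for the security parameter `l` within a number of steps polynomial in `l`. -/

/-- Programs. Variables are named by natural numbers. The instructions are `x := c`, `x := y + z`,
`x := y - z` (truncated), `x := ⌊y / 2⌋`, output of a gate whose addresses are the values of the
given variables, composition, and `while x ≠ 0 do p`. -/
inductive Prog where
  | const (x c : ℕ)
  | add (x y z : ℕ)
  | sub (x y z : ℕ)
  | half (x y : ℕ)
  | emit (g : Gate)
  | seq (p q : Prog)
  | loop (x : ℕ) (p : Prog)

/-- `Exec p σ σ' C t`: started in the store `σ`, the program `p` halts after `t` steps in the store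
`σ'`, having output the circuit `C`. -/
inductive Exec : Prog → (ℕ → ℕ) → (ℕ → ℕ) → Circuit → ℕ → Prop where
  | const (x c : ℕ) (σ : ℕ → ℕ) :
      Exec (.const x c) σ (Function.update σ x c) [] 1
  | add (x y z : ℕ) (σ : ℕ → ℕ) :
      Exec (.add x y z) σ (Function.update σ x (σ y + σ z)) [] 1
  | sub (x y z : ℕ) (σ : ℕ → ℕ) :
      Exec (.sub x y z) σ (Function.update σ x (σ y - σ z)) [] 1
  | half (x y : ℕ) (σ : ℕ → ℕ) :
      Exec (.half x y) σ (Function.update σ x (σ y / 2)) [] 1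
  | emit (g : Gate) (σ : ℕ → ℕ) :
      Exec (.emit g) σ σ [g.map σ] 1
  | seq {p q : Prog} {σ σ' σ'' : ℕ → ℕ} {C D : Circuit} {t u : ℕ} :
      Exec p σ σ' C t → Exec q σ' σ'' D u → Exec (.seq p q) σ σ'' (C ++ D) (t + u)
  | loop_done {x : ℕ} {p : Prog} {σ : ℕ → ℕ} :
      σ x = 0 → Exec (.loop x p) σ σ [] 1
  | loop_step {x : ℕ} {p : Prog} {σ σ' σ'' : ℕ → ℕ} {C D : Circuit} {t u : ℕ} :
      σ x ≠ 0 → Exec p σ σ' C t → Exec (.loop x p) σ' σ'' D u →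
        Exec (.loop x p) σ σ'' (C ++ D) (t + u + 1)

/-! ## Keyed families of unitaries -/

/-- A keyed family of unitaries, indexed by the security parameter `l`: the keys are the bit strings
of length `keyLen l`, and `U l k` acts on `ℂ^(d l)`. The key length and `log d` are polynomially
bounded in `l`, and `l` is polynomially bounded in `log d`. -/
structure KeyedUnitaryFamily where
  d : ℕ → ℕ
  d_pos : ∀ l, 0 < d l
  keyLen : ℕ → ℕ
  U : ∀ l, (Fin (keyLen l) → Bool) → Matrix.unitaryGroup (Fin (d l)) ℂ
  keyLen_poly : PolyBounded keyLen
  numQubits_poly : PolyBounded fun l => numQubits (d l)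
  poly_numQubits : ∃ c : ℕ, ∀ l, l ≤ numQubits (d l) ^ c + c

namespace KeyedUnitaryFamily

variable (F : KeyedUnitaryFamily)

/-- The key space. -/
abbrev Key (l : ℕ) : Type := Fin (F.keyLen l) → Bool

/-- The public parameters given to every algorithm: the security parameter, the dimension, the
number of qubits that encode the Hilbert space, and the key length. -/
def publicInput (l : ℕ) : ℕ → ℕ
  | 0 => l
  | 1 => F.d l
  | 2 => numQubits (F.d l)
  | 3 => F.keyLen l
  | _ => 0

/-- Average over a uniformly random key. -/
def keyAvg (l : ℕ) (f : F.Key l → ℝ) : ℝ := (∑ k, f k) / (Fintype.card (F.Key l) : ℝ)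

end KeyedUnitaryFamily

/-- A quantum polynomial-time oracle algorithm: a program which on the public parameters outputs
the circuit for the security parameter `l` in time polynomial in `l`. -/
structure QPTAlgorithm (F : KeyedUnitaryFamily) where
  prog : Prog
  circuit : ℕ → Circuit
  polyTime : ∃ c : ℕ, ∀ l, ∃ t ≤ l ^ c + c, ∃ σ,
    Exec prog (F.publicInput l) σ (circuit l) t

/-! ## Haar measure on the unitary group -/

instance (d : ℕ) : MeasurableSpace (Matrix.unitaryGroup (Fin d) ℂ) := borel _

instance (d : ℕ) : BorelSpace (Matrix.unitaryGroup (Fin d) ℂ) := ⟨rfl⟩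

instance (d : ℕ) : CompactSpace (Matrix.unitaryGroup (Fin d) ℂ) := by
  apply isCompact_iff_compactSpace.mp
  have hK : IsCompact (Set.pi Set.univ fun _ : Fin d => Set.pi Set.univ fun _ : Fin d =>
      Metric.closedBall (0 : ℂ) 1) :=
    isCompact_univ_pi fun _ => isCompact_univ_pi fun _ => isCompact_closedBall _ _
  refine hK.of_isClosed_subset (isClosed_unitary (R := Matrix (Fin d) (Fin d) ℂ)) ?_
  intro A hA i _ j _
  simpa using entry_norm_bound_of_unitary hA i j

/-- The Haar probability measure on `U(d)`. -/
def haarU (d : ℕ) : MeasureTheory.Measure (Matrix.unitaryGroup (Fin d) ℂ) :=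
  MeasureTheory.Measure.haarMeasure ⊤

/-! ## Pseudorandom unitaries -/

/-- Probability that the algorithm with circuit `C` and oracle `U`, started on `|0 … 0⟩`, outputs
`1` (the output is the measured qubit `0`). -/
def acceptProb {d : ℕ} (C : Circuit) (U : Matrix (Fin d) (Fin d) ℂ) : ℝ :=
  probOne (C.run U (Finsupp.single (fun _ => false) 1)) 0

/-- The basis state with the key `k` in the qubits `0, …, m - 1` and zeros elsewhere. -/
def keyBasis {m : ℕ} (k : Fin m → Bool) : Basis := fun q => if h : q < m then k ⟨q, h⟩ else false

/-- Efficient computation: a query-free polynomial-time quantum algorithm maps `|k⟩|ψ⟩` to `U_k|ψ⟩`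
(on the register of `|ψ⟩`), up to a negligible infidelity uniform in `k` and `ψ`. -/
def EfficientlyComputable (F : KeyedUnitaryFamily) : Prop :=
  ∃ Q : QPTAlgorithm F, (∀ l, (Q.circuit l).QueryFree) ∧
    ∃ ε : ℕ → ℝ, Negligible ε ∧
      ∀ (l : ℕ) (k : F.Key l) (ψ : Fin (F.d l) → ℂ), ∑ j, ‖ψ j‖ ^ 2 = 1 →
        1 - ε l ≤ overlap
          ((Q.circuit l).run (1 : Matrix (Fin (F.d l)) (Fin (F.d l)) ℂ)
            (loadState (keyBasis k) (F.keyLen l) ψ))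
          (F.keyLen l) ((F.U l k).1.mulVec ψ)

/-- Pseudorandomness: no polynomial-time quantum oracle algorithm distinguishes `U_k`, for a random
key `k`, from a Haar random unitary. -/
def Pseudorandom (F : KeyedUnitaryFamily) : Prop :=
  ∀ A : QPTAlgorithm F, Negligible fun l =>
    |F.keyAvg l (fun k => acceptProb (A.circuit l) (F.U l k).1) -
      ∫ U, acceptProb (A.circuit l) U.1 ∂(haarU (F.d l))|

/-- Pseudorandom unitary families. -/
def IsPRU (F : KeyedUnitaryFamily) : Prop := EfficientlyComputable F ∧ Pseudorandom F

/-! ## Universal unforgeability -/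

/-- The vector `V e₀`; it is a Haar random state when `V` is a Haar random unitary. -/
def stateOf {d : ℕ} (hd : 0 < d) (V : Matrix.unitaryGroup (Fin d) ℂ) : Fin d → ℂ :=
  fun i => V.1 i ⟨0, hd⟩

/-- Probability of winning the universal unforgeability game against the unitary `U` with challenge
`ψ`. The register of the challenge is the first block of `⌈log₂ d⌉` qubits. In the learning phase
the adversary runs `learn`, with oracle access to `U`, on its own qubits only, which come after the
challenge register; it then runs `guess` on the challenge and its own qubits, without oracle, and
hands in the first block as its forgery `ω`. The challenger accepts with probability
`⟨ψ| U† ω U |ψ⟩`, which is the optimal test of equality with `U|ψ⟩`. -/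
def forgeProb {d : ℕ} (learn guess : Circuit) (U : Matrix (Fin d) (Fin d) ℂ) (ψ : Fin d → ℂ) : ℝ :=
  overlap
    (guess.run (1 : Matrix (Fin d) (Fin d) ℂ)
      (Circuit.run U (learn.map (Gate.map (· + numQubits d))) (loadState (fun _ => false) 0 ψ)))
    0 (U.mulVec ψ)

/-- Universal unforgeability: every polynomial-time quantum adversary wins the game, with a random
key and a Haar random challenge, with negligible probability only. -/
def UniversallyUnforgeable (F : KeyedUnitaryFamily) : Prop :=
  ∀ learn guess : QPTAlgorithm F, (∀ l, (guess.circuit l).QueryFree) →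
    Negligible fun l => F.keyAvg l fun k =>
      ∫ V, forgeProb (learn.circuit l) (guess.circuit l) (F.U l k).1 (stateOf (F.d_pos l) V)
        ∂(haarU (F.d l))

/-! ## Uniqueness in the diamond norm -/

/-- The trace norm: the sum of the singular values. -/
def traceNorm {ι : Type} [Fintype ι] [DecidableEq ι] (A : Matrix ι ι ℂ) : ℝ :=
  ∑ i, √((Matrix.isHermitian_conjTranspose_mul_self A).eigenvalues i)

/-- Linear maps on `d × d` matrices. -/
abbrev SuperOp (d : ℕ) := Matrix (Fin d) (Fin d) ℂ →ₗ[ℂ] Matrix (Fin d) (Fin d) ℂ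

/-- `(Λ ⊗ id)[ρ]`, with an ancilla of dimension `d`. -/
def tensorId {d : ℕ} (L : SuperOp d) (ρ : Matrix (Fin d × Fin d) (Fin d × Fin d) ℂ) :
    Matrix (Fin d × Fin d) (Fin d × Fin d) ℂ :=
  Matrix.of fun p q => L (Matrix.of fun i j => ρ (i, p.2) (j, q.2)) p.1 q.1

/-- Density matrices. -/
def IsDensity {ι : Type} [Fintype ι] (ρ : Matrix ι ι ℂ) : Prop := ρ.PosSemidef ∧ ρ.trace = 1

/-- The diamond norm distance of two quantum channels:
`max_ρ ‖(Λ₁ ⊗ id)[ρ] - (Λ₂ ⊗ id)[ρ]‖₁` over the density matrices `ρ`. -/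
def diamondDist {d : ℕ} (L₁ L₂ : SuperOp d) : ℝ :=
  ⨆ ρ : {ρ : Matrix (Fin d × Fin d) (Fin d × Fin d) ℂ // IsDensity ρ},
    traceNorm (tensorId L₁ ρ.1 - tensorId L₂ ρ.1)

/-- The channel `ρ ↦ U ρ U†`. -/
def unitaryChannel {d : ℕ} (U : Matrix.unitaryGroup (Fin d) ℂ) : SuperOp d :=
  LinearMap.mulLeft ℂ U.1 ∘ₗ LinearMap.mulRight ℂ (star U.1)

/-- The probability, over a uniformly random pair of distinct keys, that the two channels are at
diamond norm distance at least `δ`. -/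
def farProb (F : KeyedUnitaryFamily) (l : ℕ) (δ : ℝ) : ℝ :=
  ({p : F.Key l × F.Key l | p.1 ≠ p.2 ∧
      δ ≤ diamondDist (unitaryChannel (F.U l p.1)) (unitaryChannel (F.U l p.2))}.ncard : ℝ) /
    ({p : F.Key l × F.Key l | p.1 ≠ p.2}.ncard : ℝ)

/-- `δ`-uniqueness: two unitaries with random distinct keys are at diamond norm distance at least
`δ` except with negligible probability. -/
def Uniqueness (F : KeyedUnitaryFamily) (δ : ℕ → ℝ) : Prop :=
  ∃ ε : ℕ → ℝ, Negligible ε ∧ ∀ l, 1 - ε l ≤ farProb F l (δ l)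

end QPR

end

open scoped ComplexOrder

noncomputable section

namespace QPR

/-! ## Polynomially bounded functions -/

/-! The constant `δ = 1` works, because collisions between keys would allow a forgery that makes no
query at all. The forger draws its own uniform key `j`, evaluates `U_j` on the challenge `ψ` with
the efficient evaluation circuit, and hands in the result. Against the secret key `k` it wins with
probability about `|⟨U_k ψ, U_j ψ⟩|²`.

If the two channels are at diamond distance less than `1`, this fidelity is at least `1/2` for every
`ψ`: the squared Hilbert-Schmidt distance of two pure states is `2 - 2 * fidelity`, and the trace
norm dominates the Hilbert-Schmidt norm (`one_half_le_of_diamondDist_lt_one`). Equal keys give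
fidelity `1`. Hence the winning probability is at least a quarter of the probability that two
independent keys are equal or close, minus `2ε` for the infidelity `ε` of the evaluation
(`overlap_ge`, `closePairs_le_forgeProb`). Unforgeability makes the former negligible, and counting
pairs passes to distinct keys (`one_sub_closePairs_le_farProb`).

Most of the work is to realize the forger in the circuit model. The random key is a uniform
superposition entangled with an untouched copy, so that the branches stay orthogonal and the overlap
is at least the average over the keys (`sum_overlap_le_overlap_run_forgeCircuit`). Uniformity
requires a program that relocates the output of the evaluation program and surrounds it with loops
for key preparation and block swaps (`Exec.shift`, `exec_forgeProg`). -/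

theorem PolyBounded.mono {f g : ℕ → ℕ} (hg : PolyBounded g) (h : ∀ l, f l ≤ g l) :
    PolyBounded f :=
  let ⟨c, hc⟩ := hg
  ⟨c, fun l => (h l).trans (hc l)⟩

theorem PolyBounded.const (a : ℕ) : PolyBounded fun _ => a := ⟨a, fun _ => Nat.le_add_left _ _⟩

theorem PolyBounded.add {f g : ℕ → ℕ} (hf : PolyBounded f) (hg : PolyBounded g) :
    PolyBounded fun l => f l + g l := by
  obtain ⟨a, ha⟩ := hf
  obtain ⟨b, hb⟩ := hg
  -- For `l ≥ 2` the extra factor `l ^ 2 ≥ 4` absorbs both powers; for `l ≤ 1` each power is at most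
  -- `1` and the constant `2` absorbs them.
  refine ⟨a + b + 2, fun l => ?_⟩
  refine (add_le_add (ha l) (hb l)).trans ?_
  rcases Nat.lt_or_ge l 2 with hl | hl
  · have h1 : l ^ a ≤ 1 := pow_le_one' (Nat.le_of_lt_succ hl) a
    have h2 : l ^ b ≤ 1 := pow_le_one' (Nat.le_of_lt_succ hl) b
    omega
  · have h1 : l ^ a ≤ l ^ (a + b) := Nat.pow_le_pow_right (by omega) (by omega)
    have h2 : l ^ b ≤ l ^ (a + b) := Nat.pow_le_pow_right (by omega) (by omega)
    have h3 : l ^ (a + b + 2) = l ^ (a + b) * l ^ 2 := pow_add _ _ _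
    have h4 : 4 ≤ l ^ 2 := by nlinarith
    have h5 : l ^ (a + b) * 4 ≤ l ^ (a + b) * l ^ 2 := Nat.mul_le_mul_left _ h4
    omega

theorem PolyBounded.const_mul {f : ℕ → ℕ} (hf : PolyBounded f) (a : ℕ) :
    PolyBounded fun l => a * f l := by
  induction a with
  | zero => exact (PolyBounded.const 0).mono fun l => by simp
  | succ a ih => exact (ih.add hf).mono fun l => by rw [Nat.succ_mul]

/-! ## Relabelling the output of a program -/

/-- A number larger than all the variables of a gate template. -/
def Gate.varBound : Gate → ℕ
  | .had x => x + 1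
  | .tgate x => x + 1
  | .cnot x y => max (x + 1) (y + 1)
  | .toffoli x y z => max (x + 1) (max (y + 1) (z + 1))
  | .query a => a + 1

/-- A number larger than all the variables of a program. -/
def Prog.varBound : Prog → ℕ
  | .const x _ => x + 1
  | .add x y z => max (x + 1) (max (y + 1) (z + 1))
  | .sub x y z => max (x + 1) (max (y + 1) (z + 1))
  | .half x y => max (x + 1) (y + 1)
  | .emit g => g.varBound
  | .seq p q => max p.varBound q.varBound
  | .loop x p => max (x + 1) p.varBound

/-- Output of a gate with all the addresses increased by the value of the variable `N`; the
variables `N + 1`, `N + 2`, `N + 3` hold the new addresses. -/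
def Gate.emitShift (N : ℕ) : Gate → Prog
  | .had x => .seq (.add (N + 1) x N) (.emit (.had (N + 1)))
  | .tgate x => .seq (.add (N + 1) x N) (.emit (.tgate (N + 1)))
  | .cnot x y =>
      .seq (.add (N + 1) x N) (.seq (.add (N + 2) y N) (.emit (.cnot (N + 1) (N + 2))))
  | .toffoli x y z =>
      .seq (.add (N + 1) x N) (.seq (.add (N + 2) y N) (.seq (.add (N + 3) z N)
        (.emit (.toffoli (N + 1) (N + 2) (N + 3)))))
  | .query a => .seq (.add (N + 1) a N) (.emit (.query (N + 1)))

/-- The program `p` with all the addresses of its output increased by the value of the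
variable `N`. -/
def Prog.shift (N : ℕ) : Prog → Prog
  | .const x c => .const x c
  | .add x y z => .add x y z
  | .sub x y z => .sub x y z
  | .half x y => .half x y
  | .emit g => g.emitShift N
  | .seq p q => .seq (p.shift N) (q.shift N)
  | .loop x p => .loop x (p.shift N)

theorem Exec.emit_of_eq {g g' : Gate} {σ : ℕ → ℕ} (h : g.map σ = g') :
    Exec (.emit g) σ σ [g'] 1 :=
  h ▸ .emit g σ

/-- The bound `4` is attained by Toffoli: three additions and one output. Only the scratch variables
`N + 1`, `N + 2`, `N + 3` change. -/
theorem exec_emitShift (N : ℕ) (g : Gate) (hg : g.varBound ≤ N) (τ : ℕ → ℕ) :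
    ∃ τ' t, Exec (g.emitShift N) τ τ' [(g.map τ).map (· + τ N)] t ∧ t ≤ 4 ∧
      ∀ v, v ≤ N ∨ N + 4 ≤ v → τ' v = τ v := by
  have key : ∀ x, x ≤ N → ∀ i, i ≠ 0 → x ≠ N + i := fun x hx i hi => by omega
  cases g with
  | had x =>
    refine ⟨_, _, .seq (.add _ _ _ _) (.emit_of_eq ?_), ?_, ?_⟩
    · simp [Gate.map]
    · norm_num
    · intro v hv
      rw [Function.update_of_ne (by omega)]
  | tgate x =>
    refine ⟨_, _, .seq (.add _ _ _ _) (.emit_of_eq ?_), ?_, ?_⟩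
    · simp [Gate.map]
    · norm_num
    · intro v hv
      rw [Function.update_of_ne (by omega)]
  | query x =>
    refine ⟨_, _, .seq (.add _ _ _ _) (.emit_of_eq ?_), ?_, ?_⟩
    · simp [Gate.map]
    · norm_num
    · intro v hv
      rw [Function.update_of_ne (by omega)]
  | cnot x y =>
    simp only [Gate.varBound, max_le_iff] at hg
    refine ⟨_, _, .seq (.add _ _ _ _) (.seq (.add _ _ _ _) (.emit_of_eq ?_)), ?_, ?_⟩
    · simp [Gate.map, key y (by omega)]
    · norm_num
    · intro v hv
      rw [Function.update_of_ne (by omega), Function.update_of_ne (by omega)]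
  | toffoli x y z =>
    simp only [Gate.varBound, max_le_iff] at hg
    refine ⟨_, _, .seq (.add _ _ _ _) (.seq (.add _ _ _ _) (.seq (.add _ _ _ _) (.emit_of_eq ?_))), ?_, ?_⟩
    · simp [Gate.map, key y (by omega), key z (by omega)]
    · norm_num
    · intro v hv
      rw [Function.update_of_ne (by omega), Function.update_of_ne (by omega),
        Function.update_of_ne (by omega)]

theorem Gate.map_congr {σ τ : ℕ → ℕ} (g : Gate) (h : ∀ v < g.varBound, σ v = τ v) :
    g.map σ = g.map τ := by
  cases g <;> simp only [Gate.varBound, lt_max_iff] at h <;> simp only [Gate.map] <;>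
    congr 1 <;> apply h <;> simp

/-- The shifted program simulates the original one: the stores agree below `N`, hence all tests and
assignments do. The last clause protects the offset in `N` and the data that the forger keeps from
`N + 4` on. -/
theorem Exec.shift {p : Prog} {σ σ' : ℕ → ℕ} {C : Circuit} {t : ℕ} (h : Exec p σ σ' C t)
    (N : ℕ) (hp : p.varBound ≤ N) (τ : ℕ → ℕ) (hτ : ∀ v < N, τ v = σ v) :
    ∃ τ' t', Exec (p.shift N) τ τ' (C.map (Gate.map (· + τ N))) t' ∧ t' ≤ 4 * t ∧
      (∀ v < N, τ' v = σ' v) ∧ ∀ v, v = N ∨ N + 4 ≤ v → τ' v = τ v := by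
  have upd : ∀ (τ σ : ℕ → ℕ) (x a : ℕ), x < N → (∀ v < N, τ v = σ v) →
      (∀ v < N, Function.update τ x a v = Function.update σ x a v) ∧
      ∀ v, v = N ∨ N + 4 ≤ v → Function.update τ x a v = τ v := by
    intro τ σ x a hx h
    refine ⟨fun v hv => ?_, fun v hv => Function.update_of_ne (by omega) _ _⟩
    by_cases hvx : v = x
    · subst hvx; simp
    · simp [Function.update_of_ne hvx, h v hv]
  induction h generalizing τ with
  | const x c σ =>
    simp only [Prog.varBound] at hp
    obtain ⟨h1, h2⟩ := upd τ σ x c (by omega) hτ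
    exact ⟨_, _, .const _ _ _, by norm_num, h1, h2⟩
  | add x y z σ =>
    simp only [Prog.varBound, max_le_iff] at hp
    obtain ⟨h1, h2⟩ := upd τ σ x (σ y + σ z) (by omega) hτ
    rw [← hτ y (by omega), ← hτ z (by omega)] at h1 h2
    exact ⟨_, _, .add _ _ _ _, by norm_num, by rw [← hτ y (by omega), ← hτ z (by omega)]; exact h1, h2⟩
  | sub x y z σ =>
    simp only [Prog.varBound, max_le_iff] at hp
    obtain ⟨h1, h2⟩ := upd τ σ x (σ y - σ z) (by omega) hτ
    rw [← hτ y (by omega), ← hτ z (by omega)] at h1 h2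
    exact ⟨_, _, .sub _ _ _ _, by norm_num, by rw [← hτ y (by omega), ← hτ z (by omega)]; exact h1, h2⟩
  | half x y σ =>
    simp only [Prog.varBound, max_le_iff] at hp
    obtain ⟨h1, h2⟩ := upd τ σ x (σ y / 2) (by omega) hτ
    rw [← hτ y (by omega)] at h1 h2
    exact ⟨_, _, .half _ _ _, by norm_num, by rw [← hτ y (by omega)]; exact h1, h2⟩
  | emit g σ =>
    simp only [Prog.varBound] at hp
    obtain ⟨τ', t, h1, h2, h3⟩ := exec_emitShift N g hp τ
    refine ⟨τ', t, ?_, by omega, fun v hv => ?_, fun v hv => h3 v (by omega)⟩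
    · rw [← Gate.map_congr g fun v hv => hτ v (by omega)]
      exact h1
    · rw [h3 v (by omega), hτ v hv]
  | seq _ _ ih1 ih2 =>
    simp only [Prog.varBound, max_le_iff] at hp
    obtain ⟨τ₁, t₁, e₁, b₁, a₁, f₁⟩ := ih1 hp.1 τ hτ
    obtain ⟨τ₂, t₂, e₂, b₂, a₂, f₂⟩ := ih2 hp.2 τ₁ a₁
    refine ⟨τ₂, t₁ + t₂, ?_, by omega, a₂, fun v hv => by rw [f₂ v hv, f₁ v hv]⟩
    -- The offset survives the first half, so both halves are shifted by the same amount.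
    rw [f₁ N (Or.inl rfl)] at e₂
    rw [List.map_append]
    exact .seq e₁ e₂
  | loop_done h0 =>
    simp only [Prog.varBound, max_le_iff] at hp
    exact ⟨τ, 1, .loop_done (by rw [hτ _ (by omega), h0]), by norm_num, hτ, fun _ _ => rfl⟩
  | loop_step h0 _ _ ih1 ih2 =>
    have hp' := hp
    simp only [Prog.varBound, max_le_iff] at hp
    obtain ⟨τ₁, t₁, e₁, b₁, a₁, f₁⟩ := ih1 hp.2 τ hτ
    obtain ⟨τ₂, t₂, e₂, b₂, a₂, f₂⟩ := ih2 hp' τ₁ a₁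
    refine ⟨τ₂, t₁ + t₂ + 1, ?_, by omega, a₂, fun v hv => by rw [f₂ v hv, f₁ v hv]⟩
    rw [f₁ N (Or.inl rfl)] at e₂
    rw [List.map_append]
    exact .loop_step (by rwa [hτ _ (by omega)]) e₁ e₂

/-! ## Sweeping over two blocks of qubits -/

/-- The circuit `G x y, G (x + 1) (y + 1), …, G (x + k - 1) (y + k - 1)`. -/
def sweepCircuit (G : ℕ → ℕ → Circuit) : ℕ → ℕ → ℕ → Circuit
  | _, _, 0 => []
  | x, y, k + 1 => G x y ++ sweepCircuit G (x + 1) (y + 1) k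

/-- Output of the gates of a list, followed by `a := a + e`, `b := b + e`, `c := c - e`. -/
def sweepBody (a b c e : ℕ) : List Gate → Prog
  | [] => .seq (.add a a e) (.seq (.add b b e) (.sub c c e))
  | g :: L => .seq (.emit g) (sweepBody a b c e L)

theorem exec_sweepBody {a b c e : ℕ} (hab : a ≠ b) (hac : a ≠ c) (hbc : b ≠ c) (hea : e ≠ a)
    (heb : e ≠ b) (L : List Gate) (σ : ℕ → ℕ) :
    ∃ σ', Exec (sweepBody a b c e L) σ σ' (L.map (Gate.map σ)) (L.length + 3) ∧
      σ' a = σ a + σ e ∧ σ' b = σ b + σ e ∧ σ' c = σ c - σ e ∧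
      ∀ v, v ≠ a → v ≠ b → v ≠ c → σ' v = σ v := by
  induction L with
  | nil =>
    refine ⟨_, .seq (.add _ _ _ _) (.seq (.add _ _ _ _) (.sub _ _ _ _)), ?_, ?_, ?_, ?_⟩
    · simp [Function.update_apply, hab, hac]
    · simp [Function.update_apply, hab.symm, hbc, hea]
    · simp [Function.update_apply, hac.symm, hbc.symm, hea, heb]
    · intro v h1 h2 h3
      simp [Function.update_apply, h1, h2, h3]
  | cons g L ih =>
    obtain ⟨σ', h, h'⟩ := ih
    refine ⟨σ', ?_, h'⟩
    have := Exec.seq (Exec.emit g σ) h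
    rw [show (g :: L).length + 3 = 1 + (L.length + 3) by simp; omega]
    exact this

/-- Each round costs `L.length` outputs, three updates and one loop test. The variable `e` holds the
constant `1`, since the instructions have no immediate increment. -/
theorem exec_sweep {a b c e : ℕ} (hab : a ≠ b) (hac : a ≠ c) (hbc : b ≠ c) (hea : e ≠ a)
    (heb : e ≠ b) (hec : e ≠ c) (L : List Gate) (G : ℕ → ℕ → Circuit)
    (hL : ∀ σ, L.map (Gate.map σ) = G (σ a) (σ b)) (k : ℕ) :
    ∀ σ : ℕ → ℕ, σ c = k → σ e = 1 →
    ∃ σ', Exec (.loop c (sweepBody a b c e L)) σ σ' (sweepCircuit G (σ a) (σ b) k)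
        (k * (L.length + 4) + 1) ∧
      ∀ v, v ≠ a → v ≠ b → v ≠ c → σ' v = σ v := by
  induction k with
  | zero =>
    intro σ hc _
    exact ⟨σ, by simpa [sweepCircuit] using Exec.loop_done hc, fun _ _ _ _ => rfl⟩
  | succ k ih =>
    intro σ hc he
    obtain ⟨σ₁, e₁, ha₁, hb₁, hc₁, h₁⟩ := exec_sweepBody hab hac hbc hea heb L σ
    obtain ⟨σ₂, e₂, h₂⟩ := ih σ₁ (by rw [hc₁, hc, he]; rfl) (by rw [h₁ e hea heb hec, he])
    refine ⟨σ₂, ?_, fun v h1 h2 h3 => by rw [h₂ v h1 h2 h3, h₁ v h1 h2 h3]⟩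
    rw [ha₁, hb₁, he] at e₂
    have := Exec.loop_step (by rw [hc]; exact k.succ_ne_zero) e₁ e₂
    rw [hL] at this
    rw [show (k + 1) * (L.length + 4) + 1 = L.length + 3 + (k * (L.length + 4) + 1) + 1 by ring]
    exact this

/-! ## The forger

It prepares a uniformly random key with a copy of it, and evaluates the corresponding unitary on
the challenge. -/

/-- Hadamard gate on `x`, and a copy of the qubit `x` into `y`. -/
def coinGates (x y : ℕ) : Circuit := [.had x, .cnot x y]

/-- Exchange of two qubits. -/
def swapGates (x y : ℕ) : Circuit := [.cnot x y, .cnot y x, .cnot x y]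

/-- The circuit of the forger, for challenges on `n` qubits, keys of length `m`, and the
evaluation circuit `C`. -/
def forgeCircuit (n m : ℕ) (C : Circuit) : Circuit :=
  sweepCircuit coinGates n (n + m) m ++ (sweepCircuit swapGates 0 (n + m + m) n ++
    (C.map (Gate.map (· + (n + m))) ++ sweepCircuit swapGates 0 (n + m + m) n))

/-- Exchange of the first block of qubits with the block that starts at the value of `N + 10`;
the variable `N + 9` holds the length of the blocks. -/
def swapProg (N : ℕ) : Prog :=
  .seq (.const (N + 5) 0) (.seq (.add (N + 6) (N + 10) (N + 5)) (.seq (.add (N + 7) (N + 9) (N + 5))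
    (.loop (N + 7) (sweepBody (N + 5) (N + 6) (N + 7) (N + 4) (swapGates (N + 5) (N + 6))))))

/-- Preparation of the key and of the variables of the forger. -/
def coinProg (N : ℕ) : Prog :=
  .seq (.const (N + 4) 1) (.seq (.const (N + 8) 0) (.seq (.add N 2 3) (.seq (.add (N + 9) 2 (N + 8))
    (.seq (.add (N + 10) N 3) (.seq (.add (N + 5) 2 (N + 8)) (.seq (.add (N + 6) N (N + 8))
      (.seq (.add (N + 7) 3 (N + 8))
        (.loop (N + 7)
          (sweepBody (N + 5) (N + 6) (N + 7) (N + 4) (coinGates (N + 5) (N + 6)))))))))))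

/-- The program of the forger; `p` is the program of the evaluation algorithm, with variables less
than `N`. -/
def forgeProg (N : ℕ) (p : Prog) : Prog :=
  .seq (coinProg N) (.seq (swapProg N) (.seq (p.shift N) (swapProg N)))

theorem exec_swapProg (N n s : ℕ) (σ : ℕ → ℕ) (h4 : σ (N + 4) = 1) (h9 : σ (N + 9) = n)
    (h10 : σ (N + 10) = s) :
    ∃ σ', Exec (swapProg N) σ σ' (sweepCircuit swapGates 0 s n) (n * 7 + 4) ∧
      ∀ v, v < N + 5 ∨ N + 8 ≤ v → σ' v = σ v := by
  let τ := Function.update (Function.update (Function.update σ (N + 5) 0) (N + 6) s) (N + 7) n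
  obtain ⟨σ', e, h⟩ := exec_sweep (a := N + 5) (b := N + 6) (c := N + 7) (e := N + 4)
    (by omega) (by omega) (by omega) (by omega) (by omega) (by omega)
    (swapGates (N + 5) (N + 6)) swapGates (fun _ => rfl) n τ (by simp [τ])
    (by simp [τ, h4])
  refine ⟨σ', ?_, fun v hv => ?_⟩
  · have e' := Exec.seq (.const (N + 5) 0 σ) (.seq (.add (N + 6) (N + 10) (N + 5) _)
      (.seq (.add (N + 7) (N + 9) (N + 5) _) (by
        convert e using 1
        simp [τ, h9, h10])))
    have ha : τ (N + 5) = 0 := by simp [τ]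
    have hb : τ (N + 6) = s := by simp [τ]
    rw [ha, hb] at e'
    rw [show n * 7 + 4 = 1 + (1 + (1 + (n * (3 + 4) + 1))) by ring]
    exact e'
  · rw [h v (by omega) (by omega) (by omega)]
    simp only [τ]
    rw [Function.update_of_ne (by omega), Function.update_of_ne (by omega),
      Function.update_of_ne (by omega)]

/-- The variable `N + 8` holds `0`, so that adding it copies a variable. The values left in `N`, `N
+ 4`, `N + 9` and `N + 10` serve the relocated evaluation program and both swaps. -/
theorem exec_coinProg (N n m : ℕ) (hN : 4 ≤ N) (σ : ℕ → ℕ) (h2 : σ 2 = n) (h3 : σ 3 = m) :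
    ∃ σ', Exec (coinProg N) σ σ' (sweepCircuit coinGates n (n + m) m) (m * 6 + 9) ∧
      (∀ v < N, σ' v = σ v) ∧ σ' N = n + m ∧ σ' (N + 4) = 1 ∧ σ' (N + 9) = n ∧
      σ' (N + 10) = n + m + m := by
  let τ := Function.update (Function.update (Function.update (Function.update (Function.update
    (Function.update (Function.update (Function.update σ (N + 4) 1) (N + 8) 0) N (n + m))
      (N + 9) n) (N + 10) (n + m + m)) (N + 5) n) (N + 6) (n + m)) (N + 7) m
  have e2' : 2 ≠ N := by omega
  have e3' : 3 ≠ N := by omega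
  obtain ⟨σ', e, h⟩ := exec_sweep (a := N + 5) (b := N + 6) (c := N + 7) (e := N + 4)
    (by omega) (by omega) (by omega) (by omega) (by omega) (by omega)
    (coinGates (N + 5) (N + 6)) coinGates (fun _ => rfl) m τ (by simp [τ])
    (by simp [τ])
  refine ⟨σ', ?_, fun v hv => ?_, ?_, ?_, ?_, ?_⟩
  · have e' := Exec.seq (.const (N + 4) 1 σ) (.seq (.const (N + 8) 0 _) (.seq (.add N 2 3 _)
      (.seq (.add (N + 9) 2 (N + 8) _) (.seq (.add (N + 10) N 3 _) (.seq (.add (N + 5) 2 (N + 8) _)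
        (.seq (.add (N + 6) N (N + 8) _) (.seq (.add (N + 7) 3 (N + 8) _) (by
          convert e using 1
          simp [τ, h2, h3, e2', e3']))))))))
    have ha : τ (N + 5) = n := by simp [τ]
    have hb : τ (N + 6) = n + m := by simp [τ]
    rw [ha, hb] at e'
    rw [show m * 6 + 9 = 1 + (1 + (1 + (1 + (1 + (1 + (1 + (1 + (m * (2 + 4) + 1)))))))) by ring]
    exact e'
  · rw [h v (by omega) (by omega) (by omega)]
    simp only [τ]
    repeat rw [Function.update_of_ne (by omega)]
  all_goals
    rw [h _ (by omega) (by omega) (by omega)]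
    simp [τ]

/-- The second swap can reuse the variables of the first because the relocated program leaves
everything from `N + 4` on unchanged. -/
theorem exec_forgeProg {p : Prog} {σ σ' : ℕ → ℕ} {C : Circuit} {t : ℕ} (h : Exec p σ σ' C t)
    (N : ℕ) (hN : 4 ≤ N) (hp : p.varBound ≤ N) :
    ∃ t' ≤ 4 * t + 6 * σ 3 + 14 * σ 2 + 17, ∃ τ,
      Exec (forgeProg N p) σ τ (forgeCircuit (σ 2) (σ 3) C) t' := by
  obtain ⟨σ₁, e₁, a₁, aN, a4, a9, a10⟩ := exec_coinProg N (σ 2) (σ 3) hN σ rfl rfl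
  obtain ⟨σ₂, e₂, a₂⟩ := exec_swapProg N _ _ σ₁ a4 a9 a10
  obtain ⟨σ₃, t₃, e₃, ht₃, -, a₃⟩ := h.shift N hp σ₂
    fun v hv => by rw [a₂ v (by omega), a₁ v hv]
  obtain ⟨σ₄, e₄, -⟩ := exec_swapProg N (σ 2) (σ 2 + σ 3 + σ 3) σ₃
    (by rw [a₃ _ (by omega), a₂ _ (by omega), a4])
    (by rw [a₃ _ (by omega), a₂ _ (by omega), a9])
    (by rw [a₃ _ (by omega), a₂ _ (by omega), a10])
  rw [a₂ N (by omega), aN] at e₃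
  exact ⟨_, by omega, σ₄, .seq e₁ (.seq e₂ (.seq e₃ e₄))⟩

/-- The forger, as a polynomial-time algorithm. -/
def forger {F : KeyedUnitaryFamily} (Q : QPTAlgorithm F) : QPTAlgorithm F where
  prog := forgeProg (Q.prog.varBound + 4) Q.prog
  circuit l := forgeCircuit (numQubits (F.d l)) (F.keyLen l) (Q.circuit l)
  polyTime := by
    obtain ⟨c, hc⟩ := Q.polyTime
    choose t ht σ hσ using hc
    have key : PolyBounded fun l => 4 * t l + 6 * F.keyLen l + 14 * numQubits (F.d l) + 17 :=
      (((PolyBounded.const_mul ⟨c, ht⟩ 4).add (F.keyLen_poly.const_mul 6)).add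
        (F.numQubits_poly.const_mul 14)).add (PolyBounded.const 17)
    obtain ⟨c', hc'⟩ := key
    refine ⟨c', fun l => ?_⟩
    -- The summand `4` in `N` keeps the public inputs, stored in the variables `0` to `3`, out of
    -- the forger's workspace.
    obtain ⟨t', ht', τ, e⟩ :=
      exec_forgeProg (hσ l) (Q.prog.varBound + 4) (Nat.le_add_left _ _) (Nat.le_add_right _ _)
    exact ⟨t', ht'.trans (hc' l), τ, e⟩

/-- The algorithm that does nothing. -/
def idleAlgorithm (F : KeyedUnitaryFamily) : QPTAlgorithm F where
  prog := .const 0 0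
  circuit _ := []
  polyTime := ⟨1, fun _ => ⟨1, Nat.le_add_left _ _, _, .const _ _ _⟩⟩

theorem queryFree_sweepCircuit {G : ℕ → ℕ → Circuit} (hG : ∀ x y, (G x y).QueryFree) (k : ℕ) :
    ∀ x y, (sweepCircuit G x y k).QueryFree := by
  induction k with
  | zero => intro x y a; simp [sweepCircuit]
  | succ k ih =>
    intro x y a
    simp only [sweepCircuit, List.mem_append, not_or]
    exact ⟨hG x y a, ih _ _ a⟩

theorem Circuit.QueryFree.forgeCircuit {C : Circuit} (hC : C.QueryFree) (n m : ℕ) :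
    (forgeCircuit n m C).QueryFree := by
  intro a
  have h1 := queryFree_sweepCircuit (G := coinGates) (fun x y a => by simp [coinGates])
  have h2 := queryFree_sweepCircuit (G := swapGates) (fun x y a => by simp [swapGates])
  simp only [QPR.forgeCircuit, List.mem_append, not_or, List.mem_map, not_exists, not_and]
  refine ⟨h1 _ _ _ a, h2 _ _ _ a, fun g hg => ?_, h2 _ _ _ a⟩
  cases g with
  | query b => exact absurd hg (hC b)
  | _ => simp [Gate.map]

/-! ## Linearity of circuits -/

theorem Gate.apply_eq_linearCombination {d : ℕ} (U : Matrix (Fin d) (Fin d) ℂ) (g : Gate)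
    (Ψ : QState) : g.apply U Ψ = Finsupp.linearCombination ℂ (g.onBasis U) Ψ :=
  rfl


section

variable {d : ℕ} (U : Matrix (Fin d) (Fin d) ℂ)

theorem Circuit.run_nil (Ψ : QState) : Circuit.run U [] Ψ = Ψ := rfl

theorem Circuit.run_cons (g : Gate) (C : Circuit) (Ψ : QState) :
    Circuit.run U (g :: C) Ψ = Circuit.run U C (g.apply U Ψ) := rfl

theorem Circuit.run_append (C D : Circuit) (Ψ : QState) :
    Circuit.run U (C ++ D) Ψ = Circuit.run U D (Circuit.run U C Ψ) :=
  List.foldl_append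

theorem Circuit.run_add (C : Circuit) (Φ Ψ : QState) :
    C.run U (Φ + Ψ) = C.run U Φ + C.run U Ψ := by
  induction C generalizing Φ Ψ with
  | nil => rfl
  | cons g C ih =>
    simp only [Circuit.run_cons, Gate.apply_eq_linearCombination, map_add, ih]

theorem Circuit.run_smul (C : Circuit) (a : ℂ) (Ψ : QState) :
    C.run U (a • Ψ) = a • C.run U Ψ := by
  induction C generalizing Ψ with
  | nil => rfl
  | cons g C ih =>
    simp only [Circuit.run_cons, Gate.apply_eq_linearCombination, map_smul, ih]

theorem Circuit.run_sum {ι : Type*} (C : Circuit) (A : Finset ι) (Ψ : ι → QState) :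
    C.run U (∑ i ∈ A, Ψ i) = ∑ i ∈ A, C.run U (Ψ i) :=
  map_sum (⟨⟨C.run U, C.run_add U⟩, C.run_smul U⟩ : QState →ₗ[ℂ] QState) Ψ A

theorem Circuit.run_single (C : Circuit) (s : Basis) (a : ℂ) :
    C.run U (Finsupp.single s a) = a • C.run U (Finsupp.single s 1) := by
  rw [← Circuit.run_smul, Finsupp.smul_single, smul_eq_mul, mul_one]

theorem Circuit.run_eq_sum (C : Circuit) (Ψ : QState) :
    C.run U Ψ = ∑ s ∈ Ψ.support, Ψ s • C.run U (Finsupp.single s 1) := by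
  conv_lhs => rw [← Ψ.sum_single]
  rw [Finsupp.sum, Circuit.run_sum]
  exact Finset.sum_congr rfl fun s _ => Circuit.run_single U C s _

theorem Gate.apply_single (g : Gate) (s : Basis) : g.apply U (Finsupp.single s 1) = g.onBasis U s := by
  rw [Gate.apply_eq_linearCombination, Finsupp.linearCombination_single, one_smul]

/-- A circuit that permutes the basis states acts by transport of superpositions. -/
theorem Circuit.run_eq_mapDomain {C : Circuit} {f : Basis → Basis}
    (h : ∀ s, C.run U (Finsupp.single s 1) = Finsupp.single (f s) 1) (Ψ : QState) :
    C.run U Ψ = Ψ.mapDomain f := by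
  rw [Circuit.run_eq_sum, Finsupp.mapDomain, Finsupp.sum]
  refine Finset.sum_congr rfl fun s _ => ?_
  rw [h, Finsupp.smul_single, smul_eq_mul, mul_one]

/-! ## Exchange of blocks -/

/-- The involution of the addresses that exchanges the blocks of length `k` at `x` and `y`. -/
def blockSwap (x y k q : ℕ) : ℕ :=
  if x ≤ q ∧ q < x + k then q - x + y else if y ≤ q ∧ q < y + k then q - y + x else q

theorem blockSwap_blockSwap {x y k : ℕ} (h : x + k ≤ y) (q : ℕ) :
    blockSwap x y k (blockSwap x y k q) = q := by
  unfold blockSwap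
  split_ifs <;> omega

theorem run_swapGates {x y : ℕ} (h : x ≠ y) (s : Basis) :
    Circuit.run U (swapGates x y) (Finsupp.single s 1) =
      Finsupp.single (s ∘ blockSwap x y 1) 1 := by
  simp only [swapGates, Circuit.run_cons, Circuit.run_nil, Gate.apply_single, Gate.onBasis, h,
    h.symm, if_false]
  congr 1
  funext q
  simp only [Function.comp, Function.update_apply]
  by_cases hx : q = x
  · subst hx
    rw [show blockSwap q y 1 q = y by unfold blockSwap; split_ifs <;> omega]
    simp [h]
    cases s q <;> cases s y <;> rfl
  · by_cases hy : q = y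
    · subst hy
      rw [show blockSwap x q 1 q = x by unfold blockSwap; split_ifs <;> omega]
      simp [h, h.symm]
    · rw [show blockSwap x y 1 q = q by unfold blockSwap; split_ifs <;> omega]
      simp [hx, hy]

theorem run_sweepCircuit_swapGates (k : ℕ) : ∀ {x y : ℕ}, x + k ≤ y → ∀ s : Basis,
    Circuit.run U (sweepCircuit swapGates x y k) (Finsupp.single s 1) =
      Finsupp.single (s ∘ blockSwap x y k) 1 := by
  induction k with
  | zero =>
    intro x y _ s
    have : blockSwap x y 0 = id := by
      funext q
      have h1 : ¬ (x ≤ q ∧ q < x + 0) := by omega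
      have h2 : ¬ (y ≤ q ∧ q < y + 0) := by omega
      simp only [blockSwap, h1, h2, if_false, id]
    rw [this]
    rfl
  | succ k ih =>
    intro x y h s
    rw [sweepCircuit, Circuit.run_append, run_swapGates U (by omega), ih (by omega)]
    congr 1
    funext q
    simp only [Function.comp]
    congr 1
    unfold blockSwap
    split_ifs <;> omega

/-! ## Preparation of the key -/

/-- The basis state `s` with the string `k` written both at `x` and at `y`. -/
def putTwice {m : ℕ} (s : Basis) (x y : ℕ) (k : Fin m → Bool) : Basis := fun q =>
  if x ≤ q ∧ q < x + m then keyBasis k (q - x)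
  else if y ≤ q ∧ q < y + m then keyBasis k (q - y) else s q

theorem keyBasis_cons_zero {m : ℕ} (b : Bool) (k : Fin m → Bool) :
    keyBasis (Fin.cons b k : Fin (m + 1) → Bool) 0 = b := by
  simp only [keyBasis, Nat.zero_lt_succ, dif_pos]
  rfl

theorem keyBasis_cons_succ {m : ℕ} (b : Bool) (k : Fin m → Bool) (q : ℕ) :
    keyBasis (Fin.cons b k : Fin (m + 1) → Bool) (q + 1) = keyBasis k q := by
  unfold keyBasis
  by_cases h : q < m
  · rw [dif_pos h, dif_pos (Nat.succ_lt_succ h)]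
    rfl
  · rw [dif_neg h, dif_neg (by omega)]

/-- Inductive step of the key preparation: the first round of the sweep fixes the first bit in both
copies. -/
theorem putTwice_cons {m : ℕ} (s : Basis) {x y : ℕ} (h : x + (m + 1) ≤ y) (b : Bool)
    (k : Fin m → Bool) :
    putTwice s x y (Fin.cons b k : Fin (m + 1) → Bool) =
      putTwice (Function.update (Function.update s x b) y b) (x + 1) (y + 1) k := by
  have key : ∀ z q : ℕ, z ≤ q → keyBasis (Fin.cons b k : Fin (m + 1) → Bool) (q - z) =
      if q = z then b else keyBasis k (q - (z + 1)) := by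
    intro z q hq
    split_ifs with hz
    · subst hz; rw [Nat.sub_self, keyBasis_cons_zero]
    · rw [show q - z = q - (z + 1) + 1 by omega, keyBasis_cons_succ]
  funext q
  simp only [putTwice, Function.update_apply]
  by_cases h1 : x ≤ q ∧ q < x + (m + 1)
  · rw [if_pos h1, key x q h1.1]
    by_cases hx : q = x
    · rw [if_pos hx, if_neg (by omega), if_neg (by omega), if_neg (by omega), if_pos hx]
    · rw [if_neg hx, if_pos (by omega)]
  · rw [if_neg h1]
    by_cases h2 : y ≤ q ∧ q < y + (m + 1)
    · rw [if_pos h2, key y q h2.1]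
      by_cases hy : q = y
      · rw [if_pos hy, if_neg (by omega), if_neg (by omega), if_pos hy]
      · rw [if_neg hy, if_neg (by omega), if_pos (by omega)]
    · rw [if_neg h2, if_neg (by omega), if_neg (by omega), if_neg (by omega), if_neg (by omega)]

theorem run_coinGates {x y : ℕ} (h : x ≠ y) (s : Basis) (hx : s x = false) (hy : s y = false) :
    Circuit.run U (coinGates x y) (Finsupp.single s 1) =
      ∑ b : Bool, (1 / (√2 : ℂ)) •
        Finsupp.single (Function.update (Function.update s x b) y b) 1 := by
  simp only [coinGates, Circuit.run_cons, Circuit.run_nil, Gate.apply_single]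
  simp only [Gate.onBasis, hx, Gate.apply_eq_linearCombination, map_add,
    Finsupp.linearCombination_single, h, if_false, Function.update_self,
    Function.update_of_ne h.symm, hy, Fintype.sum_bool]
  rw [add_comm]
  simp

theorem run_sweepCircuit_coinGates (m : ℕ) : ∀ {x y : ℕ}, x + m ≤ y → ∀ s : Basis,
    (∀ q, x ≤ q → q < x + m → s q = false) → (∀ q, y ≤ q → q < y + m → s q = false) →
    Circuit.run U (sweepCircuit coinGates x y m) (Finsupp.single s 1) =
      ∑ k : Fin m → Bool, (1 / (√2 : ℂ)) ^ m • Finsupp.single (putTwice s x y k) 1 := by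
  induction m with
  | zero =>
    intro x y _ s _ _
    rw [Fintype.sum_unique, pow_zero, one_smul]
    change Finsupp.single s 1 = _
    congr 1
    funext q
    rw [putTwice, if_neg (by omega), if_neg (by omega)]
  | succ m ih =>
    intro x y h s hx hy
    -- The sum over the keys is split into the first bit, produced by this round, and the remaining
    -- bits, produced by the induction hypothesis.
    rw [sweepCircuit, Circuit.run_append, run_coinGates U (by omega) s (hx x le_rfl (by omega))
      (hy y le_rfl (by omega)), Circuit.run_sum,
      ← (Fin.consEquiv fun _ : Fin (m + 1) => Bool).sum_comp, Fintype.sum_prod_type]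
    refine Finset.sum_congr rfl fun b _ => ?_
    rw [Circuit.run_smul, ih (by omega), Finset.smul_sum]
    · refine Finset.sum_congr rfl fun k _ => ?_
      rw [smul_smul, pow_succ']
      congr 2
      exact (putTwice_cons s h b k).symm
    · intro q h1 h2
      rw [Function.update_of_ne (by omega), Function.update_of_ne (by omega),
        hx q (by omega) (by omega)]
    · intro q h1 h2
      rw [Function.update_of_ne (by omega), Function.update_of_ne (by omega),
        hy q (by omega) (by omega)]

/-! ## Translated circuits -/

/-- The basis state which is `u` on the addresses less than `s` and the translate of `t` above. -/
def glue (s : ℕ) (u t : Basis) : Basis := fun q => if q < s then u q else t (q - s)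

theorem glue_add (s : ℕ) (u t : Basis) (q : ℕ) : glue s u t (q + s) = t q := by
  rw [glue, if_neg (by omega), Nat.add_sub_cancel]

theorem glue_update (s : ℕ) (u t : Basis) (x : ℕ) (b : Bool) :
    Function.update (glue s u t) (x + s) b = glue s u (Function.update t x b) := by
  funext q
  simp only [glue, Function.update_apply]
  by_cases h : q < s
  · simp [h, show q ≠ x + s by omega]
  · have : q = x + s ↔ q - s = x := by omega
    simp [h, this]

theorem glue_injective (s : ℕ) (u : Basis) : Function.Injective (glue s u) := by
  intro t t' h
  funext q
  rw [← glue_add s u t q, h, glue_add]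

/-- A translated gate neither reads nor changes the addresses below `s`, so it commutes with the
embedding that puts `u` there. -/
theorem Gate.apply_map_add (g : Gate) (hg : ∀ a, g ≠ .query a) (s : ℕ) (u : Basis) (Ψ : QState) :
    (g.map (· + s)).apply U (Ψ.mapDomain (glue s u)) = (g.apply U Ψ).mapDomain (glue s u) := by
  have hb : ∀ t, (g.map (· + s)).onBasis U (glue s u t) =
      (g.onBasis U t).mapDomain (glue s u) := by
    intro t
    cases g with
    | query a => exact absurd rfl (hg a)
    | had x =>
      simp only [Gate.map, Gate.onBasis, glue_add, glue_update, Finsupp.mapDomain_add,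
        Finsupp.mapDomain_single]
    | tgate x => simp only [Gate.map, Gate.onBasis, glue_add, Finsupp.mapDomain_single]
    | cnot x y =>
      simp only [Gate.map, Gate.onBasis, glue_add, glue_update, Finsupp.mapDomain_single,
        add_left_inj]
      split_ifs <;> rfl
    | toffoli x y z =>
      simp only [Gate.map, Gate.onBasis, glue_add, glue_update, Finsupp.mapDomain_single,
        add_left_inj]
      split_ifs <;> rfl
  rw [Gate.apply_eq_linearCombination, Finsupp.linearCombination_mapDomain,
    Gate.apply_eq_linearCombination, Finsupp.linearCombination_apply,
    Finsupp.linearCombination_apply, Finsupp.sum, Finsupp.sum, Finsupp.mapDomain_finsetSum]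
  refine Finset.sum_congr rfl fun t _ => ?_
  rw [Finsupp.mapDomain_smul, Function.comp, hb]

theorem Circuit.run_map_add {C : Circuit} (hC : C.QueryFree) (s : ℕ) (u : Basis) (Ψ : QState) :
    Circuit.run U (C.map (Gate.map (· + s))) (Ψ.mapDomain (glue s u)) =
      (C.run U Ψ).mapDomain (glue s u) := by
  induction C generalizing Ψ with
  | nil => rfl
  | cons g C ih =>
    rw [List.map_cons, Circuit.run_cons, Circuit.run_cons,
      Gate.apply_map_add U g (fun a h => hC a (by simp [h])),
      ih fun a ha => hC a (List.mem_cons_of_mem _ ha)]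

end

/-! ## The final state of the forger -/

/-- The embedding of the basis states of the evaluation algorithm, run with key `k`, into those of
the forger. -/
def forgeEmbed {m : ℕ} (n : ℕ) (k : Fin m → Bool) (t : Basis) : Basis :=
  glue (n + m) (fun q => if q < n then false else keyBasis k (q - n)) t ∘
    blockSwap 0 (n + m + m) n

/-- Layout after the first swap: `n` zeros, the reference copy of the key, and from `n + m` on
exactly the input of the evaluation circuit, that is the working key followed by the challenge. -/
theorem putTwice_writeReg_comp_blockSwap {m : ℕ} (n j : ℕ) (k : Fin m → Bool) :
    putTwice (writeReg (fun _ => false) 0 n j) n (n + m) k ∘ blockSwap 0 (n + m + m) n =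
      glue (n + m) (fun q => if q < n then false else keyBasis k (q - n))
        (writeReg (keyBasis k) m n j) := by
  have hk : ∀ q, m ≤ q → keyBasis k q = false := fun q hq => by
    rw [keyBasis, dif_neg (by omega)]
  funext q
  rw [Function.comp_apply]
  by_cases h1 : q < n
  · rw [show blockSwap 0 (n + m + m) n q = q + (n + m + m) by
      unfold blockSwap; split_ifs <;> omega]
    rw [putTwice, writeReg, glue, if_neg (by omega), if_neg (by omega), if_neg (by omega),
      if_pos (by omega), if_pos h1]
  by_cases h4 : n + m + m ≤ q ∧ q < n + m + m + n
  · rw [show blockSwap 0 (n + m + m) n q = q - (n + m + m) by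
      unfold blockSwap; split_ifs <;> omega]
    rw [putTwice, writeReg, glue, writeReg, if_neg (by omega), if_neg (by omega),
      if_pos (by omega), if_neg (by omega), if_pos (by omega)]
    congr 1
    omega
  rw [show blockSwap 0 (n + m + m) n q = q by unfold blockSwap; split_ifs <;> omega]
  rw [putTwice, writeReg, glue, writeReg]
  by_cases h2 : q < n + m
  · rw [if_pos (by omega), if_pos h2, if_neg h1]
  rw [if_neg (by omega), if_neg h2, if_neg (by omega : ¬ (m ≤ q - (n + m) ∧ _))]
  by_cases h3 : q < n + m + m
  · rw [if_pos (by omega)]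
  · rw [if_neg (by omega), if_neg (by omega), hk _ (by omega)]

theorem run_forgeCircuit {d m : ℕ} (U : Matrix (Fin d) (Fin d) ℂ) {C : Circuit}
    (hC : C.QueryFree) (ψ : Fin d → ℂ) :
    (forgeCircuit (numQubits d) m C).run U (loadState (fun _ => false) 0 ψ) =
      ∑ k : Fin m → Bool, (1 / (√2 : ℂ)) ^ m •
        (C.run U (loadState (keyBasis k) m ψ)).mapDomain (forgeEmbed (numQubits d) k) := by
  set n := numQubits d
  have hswap : ∀ Ψ, Circuit.run U (sweepCircuit swapGates 0 (n + m + m) n) Ψ =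
      Ψ.mapDomain (· ∘ blockSwap 0 (n + m + m) n) :=
    Circuit.run_eq_mapDomain U (run_sweepCircuit_swapGates U n (by omega))
  have hstart : Circuit.run U (sweepCircuit swapGates 0 (n + m + m) n)
      (Circuit.run U (sweepCircuit coinGates n (n + m) m) (loadState (fun _ => false) 0 ψ)) =
      ∑ k : Fin m → Bool, (1 / (√2 : ℂ)) ^ m • (loadState (keyBasis k) m ψ).mapDomain
        (glue (n + m) (fun q => if q < n then false else keyBasis k (q - n))) := by
    have hj : ∀ j : ℕ, Circuit.run U (sweepCircuit coinGates n (n + m) m)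
        (Finsupp.single (writeReg (fun _ => false) 0 n j) 1) =
        ∑ k : Fin m → Bool, (1 / (√2 : ℂ)) ^ m •
          Finsupp.single (putTwice (writeReg (fun _ => false) 0 n j) n (n + m) k) 1 := by
      intro j
      refine run_sweepCircuit_coinGates U m le_rfl _ (fun q h1 _ => ?_) (fun q h1 _ => ?_) <;>
        rw [writeReg, if_neg (by omega)]
    simp only [loadState, Circuit.run_sum, Finsupp.mapDomain_finsetSum, Finset.smul_sum]
    rw [Finset.sum_comm]
    refine Finset.sum_congr rfl fun j _ => ?_
    rw [Circuit.run_single, hj, Circuit.run_smul, Circuit.run_sum, Finset.smul_sum]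
    refine Finset.sum_congr rfl fun k _ => ?_
    rw [Circuit.run_smul, hswap, Finsupp.mapDomain_single, Finsupp.mapDomain_single,
      putTwice_writeReg_comp_blockSwap, smul_comm, Finsupp.smul_single, smul_eq_mul, mul_one]
  rw [forgeCircuit, Circuit.run_append, Circuit.run_append, Circuit.run_append, hstart,
    Circuit.run_sum, Circuit.run_sum]
  refine Finset.sum_congr rfl fun k _ => ?_
  rw [Circuit.run_smul, Circuit.run_smul, Circuit.run_map_add U hC, hswap,
    ← Finsupp.mapDomain_comp]
  rfl

/-! ## Norms of states -/

/-- The squared norm of a state. -/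
def normSq (Ψ : QState) : ℝ := ∑ s ∈ Ψ.support, ‖Ψ s‖ ^ 2

open Classical in
/-- The orthonormal basis states of `ℓ²`. -/
def basisVec (s : Basis) : lp (fun _ : Basis => ℂ) 2 := lp.single 2 s 1

theorem orthonormal_basisVec : Orthonormal ℂ basisVec := by
  classical
  rw [orthonormal_iff_ite]
  intro s t
  simp [basisVec, lp.inner_single_left, lp.single_apply, Pi.single_apply]

/-- The orthonormal family is arbitrary so that it can be both the basis states and their images
under a gate; comparing the two shows that the gate preserves the norm. -/
theorem normSq_eq_inner {v : Basis → lp (fun _ : Basis => ℂ) 2} (hv : Orthonormal ℂ v)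
    (Ψ : QState) : (normSq Ψ : ℂ) =
      inner ℂ (Finsupp.linearCombination ℂ v Ψ) (Finsupp.linearCombination ℂ v Ψ) := by
  rw [hv.inner_finsupp_eq_sum_left, Finsupp.sum, normSq, Complex.ofReal_sum]
  refine Finset.sum_congr rfl fun s _ => ?_
  rw [Complex.conj_mul', Complex.ofReal_pow]

theorem orthonormal_onBasis {d : ℕ} (U : Matrix (Fin d) (Fin d) ℂ) (g : Gate)
    (hg : ∀ a, g ≠ .query a) :
    Orthonormal ℂ fun s => Finsupp.linearCombination ℂ basisVec (g.onBasis U s) := by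
  classical
  have he := orthonormal_iff_ite.mp orthonormal_basisVec
  -- `CNOT` and Toffoli are involutions of the basis states, degenerate cases included.
  have hperm : ∀ f : Basis → Basis, Function.Involutive f → Orthonormal ℂ fun s =>
      Finsupp.linearCombination ℂ basisVec (Finsupp.single (f s) 1) := by
    intro f hf
    simp only [Finsupp.linearCombination_single, one_smul]
    exact orthonormal_basisVec.comp f hf.injective
  cases g with
  | query a => exact absurd rfl (hg a)
  | cnot x y =>
    refine hperm _ fun s => ?_
    by_cases h : x = y
    · simp [h]
    · simp [h]
  | toffoli x y z =>
    refine hperm _ fun s => ?_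
    by_cases h : x = z ∨ y = z
    · simp [h]
    · simp only [not_or] at h
      simp [h.1, h.2]
  | tgate x =>
    rw [orthonormal_iff_ite]
    intro s t
    simp only [Gate.onBasis, Finsupp.linearCombination_single, inner_smul_left, inner_smul_right,
      he]
    by_cases h : s = t
    · subst h
      have : ‖Complex.exp (Complex.I * (Real.pi / 4))‖ = 1 := by
        rw [mul_comm, ← Complex.ofReal_ofNat, ← Complex.ofReal_div, Complex.norm_exp_ofReal_mul_I]
      split_ifs <;> simp [Complex.mul_conj', this]
    · simp [h]
  | had x =>
    have h2 : (1 / (√2 : ℂ)) * (1 / (√2 : ℂ)) = 1 / 2 := by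
      rw [div_mul_div_comm, one_mul, ← Complex.ofReal_mul, Real.mul_self_sqrt (by norm_num)]
      norm_num
    have hc : (starRingEnd ℂ) (1 / (√2 : ℂ)) = 1 / (√2 : ℂ) := by
      rw [map_div₀, map_one, Complex.conj_ofReal]
    have hft : ∀ s t : Basis, Function.update s x false ≠ Function.update t x true := by
      intro s t h
      have := congrFun h x
      simp at this
    rw [orthonormal_iff_ite]
    intro s t
    simp only [Gate.onBasis, map_add, Finsupp.linearCombination_single, inner_add_left,
      inner_add_right, inner_smul_left, inner_smul_right, he, hft, (hft _ _).symm, if_false,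
      mul_zero, add_zero, zero_add]
    -- States that agree away from `x` reduce to the `2 × 2` Hadamard matrix; otherwise the images
    -- have disjoint supports.
    by_cases hst : ∀ q, q ≠ x → s q = t q
    · have hu : ∀ b, Function.update s x b = Function.update t x b := by
        intro b
        funext q
        by_cases hq : q = x
        · subst hq; simp
        · simp [Function.update_of_ne hq, hst q hq]
      have hiff : s = t ↔ s x = t x := by
        refine ⟨fun h => h ▸ rfl, fun h => funext fun q => ?_⟩
        by_cases hq : q = x
        · subst hq; exact h
        · exact hst q hq
      simp only [hu, if_true, mul_one, hiff, hc]
      cases s x <;> cases t x <;> simp only [Bool.false_eq_true, if_false, if_true, map_neg, hc,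
        mul_neg, neg_mul, h2, reduceCtorEq] <;> norm_num
    · have hu : ∀ b, Function.update s x b ≠ Function.update t x b := by
        intro b h
        refine hst fun q hq => ?_
        simpa [Function.update_of_ne hq] using congrFun h q
      have hne : s ≠ t := fun h => hst fun q _ => h ▸ rfl
      simp [hu, hne]

theorem normSq_run {d : ℕ} (U : Matrix (Fin d) (Fin d) ℂ) {C : Circuit} (hC : C.QueryFree)
    (Ψ : QState) : normSq (C.run U Ψ) = normSq Ψ := by
  induction C generalizing Ψ with
  | nil => rfl
  | cons g C ih =>
    rw [Circuit.run_cons, ih fun a ha => hC a (List.mem_cons_of_mem _ ha), ← Complex.ofReal_inj,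
      normSq_eq_inner orthonormal_basisVec, Gate.apply_eq_linearCombination,
      normSq_eq_inner (orthonormal_onBasis U g fun a h => hC a (by simp [h]))]
    have : Finsupp.linearCombination ℂ basisVec (Finsupp.linearCombination ℂ (g.onBasis U) Ψ) =
        Finsupp.linearCombination ℂ
          (fun s => Finsupp.linearCombination ℂ basisVec (g.onBasis U s)) Ψ := by
      simp only [Finsupp.linearCombination_apply ℂ Ψ, Finsupp.sum, map_sum, map_smul]
    rw [this]

/-! ## Registers -/

theorem writeReg_writeReg (s : Basis) (a n i j : ℕ) :
    writeReg (writeReg s a n i) a n j = writeReg s a n j := by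
  funext q
  simp only [writeReg]
  split_ifs <;> rfl

theorem writeReg_inj {s t : Basis} {a n i j : ℕ} (hi : i < 2 ^ n) (hj : j < 2 ^ n)
    (h : writeReg s a n i = writeReg t a n j) : i = j := by
  refine Nat.eq_of_testBit_eq fun q => ?_
  by_cases hq : q < n
  · have := congrFun h (a + q)
    simpa [writeReg, hq] using this
  · have hp : 2 ^ n ≤ 2 ^ q := Nat.pow_le_pow_right (by norm_num) (by omega)
    rw [Nat.testBit_lt_two_pow (hi.trans_le hp), Nat.testBit_lt_two_pow (hj.trans_le hp)]

theorem val_lt_two_pow_numQubits {d : ℕ} (j : Fin d) : (j : ℕ) < 2 ^ numQubits d :=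
  j.2.trans_le (Nat.le_pow_clog (by norm_num) d)

theorem normSq_loadState {d : ℕ} (s : Basis) (a : ℕ) (ψ : Fin d → ℂ) :
    normSq (loadState s a ψ) = ∑ j, ‖ψ j‖ ^ 2 := by
  have hw : Function.Injective fun j : Fin d => writeReg s a (numQubits d) j := fun i j h =>
    Fin.ext (writeReg_inj (val_lt_two_pow_numQubits i) (val_lt_two_pow_numQubits j) h)
  have h := (orthonormal_basisVec.comp _ hw).inner_sum ψ ψ Finset.univ
  rw [← Complex.ofReal_inj, normSq_eq_inner orthonormal_basisVec]
  simp only [loadState, map_sum, Finsupp.linearCombination_single]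
  refine h.trans ?_
  rw [Complex.ofReal_sum]
  refine Finset.sum_congr rfl fun j _ => ?_
  rw [Complex.conj_mul', Complex.ofReal_pow]

/-! ## Overlaps -/

/-- Only the basis states in the definition of `overlap` contribute to it. -/
theorem sum_le_overlap {d : ℕ} (Ψ : QState) (a : ℕ) (φ : Fin d → ℂ) (R : Finset Basis)
    (hR : ∀ r ∈ R, writeReg r a (numQubits d) 0 = r) :
    ∑ r ∈ R, ‖∑ j : Fin d, star (φ j) * Ψ (writeReg r a (numQubits d) j)‖ ^ 2 ≤
      overlap Ψ a φ := by
  classical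
  rw [overlap]
  refine (Finset.sum_subset (Finset.filter_subset (fun r => r ∈ Ψ.support.image
    fun s => writeReg s a (numQubits d) 0) R) fun r hr hn => ?_).symm.trans_le
    (Finset.sum_le_sum_of_subset_of_nonneg (fun r hr => ?_) fun _ _ _ => sq_nonneg _)
  · rw [Finset.sum_eq_zero fun j _ => ?_, norm_zero, zero_pow two_ne_zero]
    by_contra h
    refine hn (Finset.mem_filter.mpr ⟨hr, Finset.mem_image.mpr
      ⟨writeReg r a (numQubits d) j, Finsupp.mem_support_iff.mpr (right_ne_zero_of_mul h), ?_⟩⟩)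
    rw [writeReg_writeReg, hR r hr]
  · convert (Finset.mem_filter.mp hr).2

/-- This frees the index set from the support of `Ψ`, which cancellations may shrink. -/
theorem overlap_eq_sum {d : ℕ} (Ψ : QState) (a : ℕ) (φ : Fin d → ℂ) (R : Finset Basis)
    (hR : ∀ r ∈ R, writeReg r a (numQubits d) 0 = r)
    (hΨ : ∀ s ∈ Ψ.support, writeReg s a (numQubits d) 0 ∈ R) :
    overlap Ψ a φ =
      ∑ r ∈ R, ‖∑ j : Fin d, star (φ j) * Ψ (writeReg r a (numQubits d) j)‖ ^ 2 := by
  classical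
  refine le_antisymm ?_ (sum_le_overlap Ψ a φ R hR)
  rw [overlap]
  refine Finset.sum_le_sum_of_subset_of_nonneg (fun r hr => ?_) fun _ _ _ => sq_nonneg _
  obtain ⟨s, hs, rfl⟩ := Finset.mem_image.mp hr
  exact hΨ s hs

/-- The slices of a state along a register have total squared norm at most that of the state. -/
theorem sum_slices_le_normSq {d : ℕ} (Ψ : QState) (a : ℕ) (R : Finset Basis)
    (hR : ∀ r ∈ R, writeReg r a (numQubits d) 0 = r) :
    ∑ r ∈ R, ∑ j : Fin d, ‖Ψ (writeReg r a (numQubits d) j)‖ ^ 2 ≤ normSq Ψ := by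
  classical
  have hinj : Set.InjOn (fun p : Basis × Fin d => writeReg p.1 a (numQubits d) p.2)
      (R ×ˢ (Finset.univ : Finset (Fin d)) : Finset _) := by
    rintro ⟨r, i⟩ hr ⟨t, j⟩ ht h
    simp only [Finset.coe_product, Set.mem_prod, Finset.mem_coe] at hr ht
    have hij := writeReg_inj (val_lt_two_pow_numQubits i) (val_lt_two_pow_numQubits j) h
    have hrt := congrArg (fun s => writeReg s a (numQubits d) 0) h
    simp only [writeReg_writeReg, hR r hr.1, hR t ht.1] at hrt
    exact Prod.ext hrt (Fin.ext hij)
  rw [← Finset.sum_product', ← Finset.sum_image (f := fun s => ‖Ψ s‖ ^ 2) hinj, normSq,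
    ← Finset.sum_filter_ne_zero]
  refine Finset.sum_le_sum_of_subset_of_nonneg (fun s hs => ?_) fun _ _ _ => sq_nonneg _
  rw [Finsupp.mem_support_iff]
  intro h
  exact (Finset.mem_filter.mp hs).2 (by simp [h])

/-! ## Vectors with nearby overlaps -/

/-- Write `v = c • b + y` with `y ⊥ b`. Then `|⟨a, b⟩ c| ≤ |⟨a, v⟩| + ‖y‖`, and `(s + t)² ≤ 2s² +
2t²` gives the claim, since `‖y‖²` is the subtracted bracket. -/
theorem norm_inner_sq_ge {E : Type*} [NormedAddCommGroup E] [InnerProductSpace ℂ E] {a b : E}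
    (ha : ‖a‖ = 1) (hb : ‖b‖ = 1) (v : E) :
    1 / 2 * ‖inner ℂ a b‖ ^ 2 * ‖inner ℂ b v‖ ^ 2 - (‖v‖ ^ 2 - ‖inner ℂ b v‖ ^ 2) ≤
      ‖inner ℂ a v‖ ^ 2 := by
  set c : ℂ := inner ℂ b v
  set y := v - c • b
  have hbb : inner ℂ b b = (1 : ℂ) := by rw [inner_self_eq_norm_sq_to_K, hb]; norm_num
  have hby : inner ℂ b y = (0 : ℂ) := by
    simp only [y, inner_sub_right, inner_smul_right, hbb, mul_one]
    exact sub_self c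
  have hv : v = c • b + y := by simp [y]
  have hvn : ‖v‖ ^ 2 = ‖c‖ ^ 2 + ‖y‖ ^ 2 := by
    have := norm_add_sq_eq_norm_sq_add_norm_sq_of_inner_eq_zero (𝕜 := ℂ) (c • b) y
      (by rw [inner_smul_left, hby, mul_zero])
    rw [← hv, norm_smul, hb, mul_one] at this
    simpa [sq] using this
  have hay : ‖inner ℂ a y‖ ≤ ‖y‖ := by
    simpa [ha] using norm_inner_le_norm (𝕜 := ℂ) a y
  have hav : inner ℂ a v = inner ℂ a b * c + inner ℂ a y := by
    conv_lhs => rw [hv]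
    rw [inner_add_right, inner_smul_right, mul_comm]
  have htri : ‖inner ℂ a b‖ * ‖c‖ ≤ ‖inner ℂ a v‖ + ‖inner ℂ a y‖ := by
    rw [← norm_mul, hav]
    have := norm_sub_le (inner ℂ a b * c + inner ℂ a y) (inner ℂ a y)
    rwa [add_sub_cancel_right] at this
  rw [hvn]
  nlinarith [sq_nonneg (‖inner ℂ a v‖ - ‖inner ℂ a y‖), norm_nonneg (inner ℂ a y),
    mul_nonneg (norm_nonneg (inner ℂ a b)) (norm_nonneg c),
    mul_self_le_mul_self (mul_nonneg (norm_nonneg (inner ℂ a b)) (norm_nonneg c)) htri,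
    mul_self_le_mul_self (norm_nonneg _) hay]

theorem inner_toLp {d : ℕ} (a b : Fin d → ℂ) :
    inner ℂ (WithLp.toLp 2 a) (WithLp.toLp 2 b) = ∑ j, star (a j) * b j := by
  rw [PiLp.inner_apply]
  exact Finset.sum_congr rfl fun j _ => mul_comm _ _

theorem norm_toLp_eq_one {d : ℕ} {a : Fin d → ℂ} (h : ∑ j, ‖a j‖ ^ 2 = 1) :
    ‖WithLp.toLp 2 a‖ = 1 := by
  rw [← sq_eq_sq₀ (norm_nonneg _) zero_le_one, EuclideanSpace.norm_sq_eq, one_pow]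
  exact h

/-- A state that is close to `b` on a register has an overlap with `a` of at least about half of
that of `b` with `a`. -/
theorem overlap_ge {d : ℕ} {Ψ : QState} (hΨ : normSq Ψ ≤ 1) (p : ℕ) {a b : Fin d → ℂ}
    (ha : ∑ j, ‖a j‖ ^ 2 = 1) (hb : ∑ j, ‖b j‖ ^ 2 = 1) {ε : ℝ} (h : 1 - ε ≤ overlap Ψ p b) :
    1 / 2 * ‖∑ j, star (a j) * b j‖ ^ 2 - 2 * ε ≤ overlap Ψ p a := by
  classical
  set n := numQubits d
  set R := Ψ.support.image fun s => writeReg s p n 0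
  have hR : ∀ r ∈ R, writeReg r p n 0 = r := by
    intro r hr
    obtain ⟨s, -, rfl⟩ := Finset.mem_image.mp hr
    exact writeReg_writeReg _ _ _ _ _
  have hmem : ∀ s ∈ Ψ.support, writeReg s p n 0 ∈ R := fun s hs => Finset.mem_image_of_mem _ hs
  have hsl := sum_slices_le_normSq (d := d) Ψ p R hR
  have ha' := norm_toLp_eq_one ha
  have hb' := norm_toLp_eq_one hb
  have hterm : ∀ r, 1 / 2 * ‖∑ j, star (a j) * b j‖ ^ 2 *
      ‖∑ j : Fin d, star (b j) * Ψ (writeReg r p n j)‖ ^ 2 -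
      (∑ j : Fin d, ‖Ψ (writeReg r p n j)‖ ^ 2 -
        ‖∑ j : Fin d, star (b j) * Ψ (writeReg r p n j)‖ ^ 2) ≤
      ‖∑ j : Fin d, star (a j) * Ψ (writeReg r p n j)‖ ^ 2 := by
    intro r
    have := norm_inner_sq_ge ha' hb' (WithLp.toLp 2 fun j : Fin d => Ψ (writeReg r p n j))
    rwa [inner_toLp, inner_toLp, inner_toLp, EuclideanSpace.norm_sq_eq] at this
  have hsum := Finset.sum_le_sum fun r (_ : r ∈ R) => hterm r
  rw [Finset.sum_sub_distrib, Finset.sum_sub_distrib, ← Finset.mul_sum,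
    ← overlap_eq_sum Ψ p a R hR hmem, ← overlap_eq_sum Ψ p b R hR hmem] at hsum
  have hab : ‖∑ j, star (a j) * b j‖ ≤ 1 := by
    have := norm_inner_le_norm (𝕜 := ℂ) (WithLp.toLp 2 a) (WithLp.toLp 2 b)
    rwa [inner_toLp, ha', hb', one_mul] at this
  -- Together with `h` this forces `0 ≤ ε`.
  have hb1 : overlap Ψ p b ≤ 1 := by
    rw [overlap_eq_sum Ψ p b R hR hmem]
    refine (Finset.sum_le_sum fun r _ => ?_).trans (hsl.trans hΨ)
    have := norm_inner_le_norm (𝕜 := ℂ) (WithLp.toLp 2 b)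
      (WithLp.toLp 2 fun j : Fin d => Ψ (writeReg r p n j))
    rw [inner_toLp, hb', one_mul] at this
    refine (pow_le_pow_left₀ (norm_nonneg _) this 2).trans_eq ?_
    rw [EuclideanSpace.norm_sq_eq]
  have hab2 : ‖∑ j, star (a j) * b j‖ ^ 2 ≤ 1 := pow_le_one₀ (norm_nonneg _) hab
  -- With `f ≤ 1` the squared inner product, the summed bound is at least `f / 2 * (1 - ε) - ε`,
  -- hence at least `f / 2 - 2 * ε`.
  nlinarith [mul_nonneg (sq_nonneg ‖∑ j, star (a j) * b j‖) (sub_nonneg.mpr h),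
    mul_nonneg (sub_nonneg.mpr hab2) (show 0 ≤ ε by linarith)]

/-! ## Success probability of the forger -/

theorem forgeEmbed_injective {m : ℕ} (n : ℕ) (k : Fin m → Bool) :
    Function.Injective (forgeEmbed n k) := by
  intro s t h
  refine glue_injective (n + m) (fun q => if q < n then false else keyBasis k (q - n))
    (funext fun q => ?_)
  have := congrFun h (blockSwap 0 (n + m + m) n q)
  simpa [forgeEmbed, blockSwap_blockSwap (show 0 + n ≤ n + m + m by omega)] using this

/-- The reference copy at `n, …, n + m - 1` is moved by neither the swap nor the evaluation, so the
key can be read off. -/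
theorem forgeEmbed_inj_key {m n : ℕ} {k k' : Fin m → Bool} {s t : Basis}
    (h : forgeEmbed n k s = forgeEmbed n k' t) : k = k' := by
  funext i
  have := congrFun h (n + i)
  have hb : blockSwap 0 (n + m + m) n (n + i) = n + i := by
    have := i.2
    unfold blockSwap
    split_ifs <;> omega
  simpa [forgeEmbed, hb, glue, keyBasis] using this

theorem writeReg_forgeEmbed {m : ℕ} (n j : ℕ) (k : Fin m → Bool) (t : Basis) :
    writeReg (forgeEmbed n k t) 0 n j = forgeEmbed n k (writeReg t m n j) := by
  funext q
  by_cases h1 : q < n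
  · have hb : blockSwap 0 (n + m + m) n q = q + (n + m + m) := by
      unfold blockSwap
      split_ifs <;> omega
    rw [writeReg, if_pos (by omega), forgeEmbed, Function.comp_apply, hb, glue,
      if_neg (by omega), writeReg, if_pos (by omega)]
    congr 1
    omega
  · rw [writeReg, if_neg (by omega), forgeEmbed, forgeEmbed, Function.comp_apply,
      Function.comp_apply]
    have hb : ¬ (n + m + m ≤ blockSwap 0 (n + m + m) n q ∧
        blockSwap 0 (n + m + m) n q < n + m + m + n) := by
      unfold blockSwap
      split_ifs <;> omega
    generalize blockSwap 0 (n + m + m) n q = q' at hb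
    rw [glue, glue]
    by_cases h2 : q' < n + m
    · rw [if_pos h2, if_pos h2]
    · rw [if_neg h2, if_neg h2, writeReg, if_neg (by omega)]

/-- Distinct keys leave distinct reference copies outside the forgery register, so their branches do
not interfere, and each contributes its overlap with weight `|2^(-m/2)|² = 2^(-m)`. -/
theorem sum_overlap_le_overlap_run_forgeCircuit {d m : ℕ} (U : Matrix (Fin d) (Fin d) ℂ)
    {C : Circuit} (hC : C.QueryFree) (ψ φ : Fin d → ℂ) :
    (∑ k : Fin m → Bool, overlap (C.run U (loadState (keyBasis k) m ψ)) m φ) / 2 ^ m ≤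
      overlap ((forgeCircuit (numQubits d) m C).run U (loadState (fun _ => false) 0 ψ)) 0 φ := by
  classical
  rw [run_forgeCircuit U hC]
  set n := numQubits d
  set Φ : (Fin m → Bool) → QState := fun k => C.run U (loadState (keyBasis k) m ψ)
  set Ψ : QState := ∑ k : Fin m → Bool, (1 / (√2 : ℂ)) ^ m • (Φ k).mapDomain (forgeEmbed n k)
  have hΨ : ∀ k t, Ψ (forgeEmbed n k t) = (1 / (√2 : ℂ)) ^ m * Φ k t := by
    intro k t
    simp only [Ψ, Finsupp.finsetSum_apply, Finsupp.smul_apply, smul_eq_mul]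
    rw [Finset.sum_eq_single k, Finsupp.mapDomain_apply (forgeEmbed_injective n k)]
    · intro k' _ hk'
      rw [Finsupp.mapDomain_of_notMem_range, mul_zero]
      rintro ⟨t', ht'⟩
      exact hk' (forgeEmbed_inj_key ht')
    · intro h
      exact absurd (Finset.mem_univ k) h
  have hnorm : ‖(1 / (√2 : ℂ)) ^ m‖ ^ 2 = 1 / 2 ^ m := by
    rw [norm_pow, norm_div, norm_one, Complex.norm_real, Real.norm_of_nonneg (Real.sqrt_nonneg 2),
      ← pow_mul, mul_comm, pow_mul, div_pow, Real.sq_sqrt (by norm_num), one_pow, div_pow, one_pow]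
  let R : (Fin m → Bool) → Finset Basis := fun k =>
    (Φ k).support.image fun s => writeReg s m n 0
  have hR : ∀ k, ∀ r ∈ R k, writeReg r m n 0 = r := by
    intro k r hr
    obtain ⟨s, -, rfl⟩ := Finset.mem_image.mp hr
    exact writeReg_writeReg _ _ _ _ _
  have hinj : Set.InjOn (fun x : (_ : Fin m → Bool) × Basis => forgeEmbed n x.1 x.2)
      (Finset.univ.sigma R : Finset _) := by
    rintro ⟨k, r⟩ _ ⟨k', r'⟩ _ h
    obtain rfl := forgeEmbed_inj_key h
    obtain rfl := forgeEmbed_injective n k h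
    rfl
  refine le_trans (le_of_eq ?_) (sum_le_overlap Ψ 0 φ
    ((Finset.univ.sigma R).image fun x => forgeEmbed n x.1 x.2) fun r hr => ?_)
  · rw [Finset.sum_image hinj, Finset.sum_sigma, Finset.sum_div]
    refine Finset.sum_congr rfl fun k _ => ?_
    rw [overlap_eq_sum (Φ k) m φ (R k) (hR k) fun s hs => Finset.mem_image_of_mem _ hs,
      Finset.sum_div]
    refine Finset.sum_congr rfl fun r _ => ?_
    have : ∀ j : Fin d, star (φ j) * Ψ (writeReg (forgeEmbed n k r) 0 n j) =
        (1 / (√2 : ℂ)) ^ m * (star (φ j) * Φ k (writeReg r m n j)) := by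
      intro j
      rw [writeReg_forgeEmbed, hΨ]
      ring
    simp only [n] at this ⊢
    simp only [this]
    rw [← Finset.mul_sum, norm_mul, mul_pow, hnorm]
    ring
  · obtain ⟨⟨k, t⟩, hkt, rfl⟩ := Finset.mem_image.mp hr
    have := hR k t (Finset.mem_sigma.mp hkt).2
    simp only
    rw [writeReg_forgeEmbed, this]

/-! ## Dependence on the challenge -/

theorem continuous_overlap_sum {X : Type*} [TopologicalSpace X] {d : ℕ} (Ψ : Fin d → QState)
    (a : ℕ) {ψ φ : X → Fin d → ℂ} (hψ : Continuous ψ) (hφ : Continuous φ) :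
    Continuous fun x => overlap (∑ i, ψ x i • Ψ i) a (φ x) := by
  classical
  set n := numQubits d
  -- One index set valid for all `x`: it exhibits the overlap as a fixed finite sum of continuous
  -- functions.
  let R : Finset Basis :=
    (Finset.univ.biUnion fun i => (Ψ i).support).image fun s => writeReg s a n 0
  have h : ∀ x, overlap (∑ i, ψ x i • Ψ i) a (φ x) = ∑ r ∈ R,
      ‖∑ j : Fin d, star (φ x j) * ∑ i, ψ x i * Ψ i (writeReg r a n j)‖ ^ 2 := by
    intro x
    rw [overlap_eq_sum _ a (φ x) R]
    · simp only [Finsupp.finsetSum_apply, Finsupp.smul_apply, smul_eq_mul]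
      rfl
    · intro r hr
      obtain ⟨s, -, rfl⟩ := Finset.mem_image.mp hr
      exact writeReg_writeReg _ _ _ _ _
    · intro s hs
      refine Finset.mem_image_of_mem _ ?_
      rw [Finsupp.mem_support_iff, Finsupp.finsetSum_apply] at hs
      obtain ⟨i, -, hi⟩ := Finset.exists_ne_zero_of_sum_ne_zero hs
      rw [Finsupp.smul_apply] at hi
      exact Finset.mem_biUnion.mpr
        ⟨i, Finset.mem_univ i, Finsupp.mem_support_iff.mpr (right_ne_zero_of_smul hi)⟩
  simp only [h]
  fun_prop

/-- Continuity on the compact group gives integrability, which monotonicity of the Haar integral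
requires. -/
theorem continuous_forgeProb {d : ℕ} (hd : 0 < d) (learn guess : Circuit)
    (U : Matrix (Fin d) (Fin d) ℂ) :
    Continuous fun V => forgeProb learn guess U (stateOf hd V) := by
  have hψ : Continuous fun V : Matrix.unitaryGroup (Fin d) ℂ => stateOf hd V :=
    continuous_pi fun i => continuous_subtype_val.matrix_elem i (⟨0, hd⟩ : Fin d)
  have hφ : Continuous fun V => U.mulVec (stateOf hd V) := continuous_const.matrix_mulVec hψ
  refine (continuous_overlap_sum (fun i => Circuit.run (1 : Matrix (Fin d) (Fin d) ℂ) guess (Circuit.run U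
    (learn.map (Gate.map (· + numQubits d)))
      (Finsupp.single (writeReg (fun _ => false) 0 (numQubits d) i) 1))) 0 hψ hφ).congr fun V => ?_
  rw [forgeProb, loadState, Circuit.run_sum, Circuit.run_sum]
  congr 2
  funext i
  rw [Circuit.run_single U _ _ (stateOf hd V i), Circuit.run_smul]

/-! ## The diamond distance of unitary channels -/

/-! ### Trace norm against Hilbert-Schmidt norm. -/

section

variable {ι : Type} [Fintype ι]

theorem trace_conjTranspose_mul_self (A : Matrix ι ι ℂ) :
    (A.conjTranspose * A).trace = ((∑ i, ∑ j, ‖A i j‖ ^ 2 : ℝ) : ℂ) := by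
  rw [Finset.sum_comm, Complex.ofReal_sum, Matrix.trace]
  refine Finset.sum_congr rfl fun j _ => ?_
  rw [Matrix.diag_apply, Matrix.mul_apply, Complex.ofReal_sum]
  refine Finset.sum_congr rfl fun i _ => ?_
  rw [Matrix.conjTranspose_apply, Complex.ofReal_pow]
  exact Complex.conj_mul' _

variable [DecidableEq ι]

theorem sum_eigenvalues_conjTranspose_mul_self (A : Matrix ι ι ℂ) :
    ∑ i, (Matrix.isHermitian_conjTranspose_mul_self A).eigenvalues i =
      ∑ i, ∑ j, ‖A i j‖ ^ 2 := by
  have h := (Matrix.isHermitian_conjTranspose_mul_self A).trace_eq_sum_eigenvalues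
  rw [trace_conjTranspose_mul_self] at h
  refine Complex.ofReal_injective ?_
  rw [Complex.ofReal_sum]
  exact h.symm

/-- The left side is the sum of the squared singular values, at most the square of their sum. -/
theorem sum_norm_sq_le_traceNorm_sq (A : Matrix ι ι ℂ) :
    ∑ i, ∑ j, ‖A i j‖ ^ 2 ≤ traceNorm A ^ 2 := by
  rw [← sum_eigenvalues_conjTranspose_mul_self, traceNorm]
  refine le_trans (le_of_eq (Finset.sum_congr rfl fun i _ => ?_))
    (Finset.sum_sq_le_sq_sum_of_nonneg fun i _ => Real.sqrt_nonneg _)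
  rw [Real.sq_sqrt ((Matrix.posSemidef_conjTranspose_mul_self A).eigenvalues_nonneg i)]

theorem traceNorm_nonneg (A : Matrix ι ι ℂ) : 0 ≤ traceNorm A :=
  Finset.sum_nonneg fun _ _ => Real.sqrt_nonneg _

theorem traceNorm_le (A : Matrix ι ι ℂ) :
    traceNorm A ≤ Fintype.card ι * √(∑ i, ∑ j, ‖A i j‖ ^ 2) := by
  rw [← sum_eigenvalues_conjTranspose_mul_self, traceNorm, ← nsmul_eq_mul]
  refine Finset.sum_le_card_nsmul _ _ _ fun i _ => Real.sqrt_le_sqrt ?_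
  exact Finset.single_le_sum
    (fun j _ => (Matrix.posSemidef_conjTranspose_mul_self A).eigenvalues_nonneg j)
    (Finset.mem_univ i)

theorem traceNorm_le_of_entry_le {A : Matrix ι ι ℂ} {c : ℝ} (h : ∀ i j, ‖A i j‖ ≤ c) :
    traceNorm A ≤ Fintype.card ι * √(∑ _i : ι, ∑ _j : ι, c ^ 2) := by
  refine (traceNorm_le A).trans (mul_le_mul_of_nonneg_left (Real.sqrt_le_sqrt ?_)
    (Nat.cast_nonneg _))
  exact Finset.sum_le_sum fun i _ => Finset.sum_le_sum fun j _ =>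
    pow_le_pow_left₀ (norm_nonneg _) (h i j) 2

open scoped MatrixOrder in
-- With `ρ = B† B`, the entries are inner products of columns of `B`, whose squared norms sum to the
-- trace `1`.
theorem IsDensity.norm_entry_le_one {ρ : Matrix ι ι ℂ} (hρ : IsDensity ρ) (i j : ι) :
    ‖ρ i j‖ ≤ 1 := by
  obtain ⟨B, hB⟩ := CStarAlgebra.nonneg_iff_eq_star_mul_self.mp hρ.1.nonneg
  rw [Matrix.star_eq_conjTranspose] at hB
  have htr : ∑ i, ∑ j, ‖B i j‖ ^ 2 = 1 := by
    have := hρ.2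
    rw [hB, trace_conjTranspose_mul_self] at this
    exact_mod_cast this
  have hcol : ∀ j, ∑ i, ‖B i j‖ ^ 2 ≤ 1 := fun j => by
    rw [← htr]
    exact Finset.sum_le_sum fun i _ =>
      Finset.single_le_sum (fun j _ => sq_nonneg ‖B i j‖) (Finset.mem_univ j)
  rw [hB, Matrix.mul_apply]
  calc ‖∑ k, B.conjTranspose i k * B k j‖ ≤ ∑ k, ‖B.conjTranspose i k * B k j‖ := norm_sum_le _ _
    _ ≤ ∑ k, (1 / 2 * ‖B k i‖ ^ 2 + 1 / 2 * ‖B k j‖ ^ 2) := by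
        refine Finset.sum_le_sum fun k _ => ?_
        rw [norm_mul, Matrix.conjTranspose_apply, norm_star]
        nlinarith [sq_nonneg (‖B k i‖ - ‖B k j‖)]
    _ ≤ 1 := by
        rw [Finset.sum_add_distrib, ← Finset.mul_sum, ← Finset.mul_sum]
        linarith [hcol i, hcol j]

end

/-! ### Unitary channels: finiteness of the diamond distance and fidelity of outputs. -/

section

variable {d : ℕ}

theorem norm_mul_entry_le {A B : Matrix (Fin d) (Fin d) ℂ} {a b : ℝ} (ha : 0 ≤ a)
    (hA : ∀ i j, ‖A i j‖ ≤ a) (hB : ∀ i j, ‖B i j‖ ≤ b) (i j : Fin d) :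
    ‖(A * B) i j‖ ≤ d * (a * b) := by
  rw [Matrix.mul_apply]
  refine (norm_sum_le _ _).trans ((Finset.sum_le_card_nsmul _ _ (a * b) fun k _ => ?_).trans_eq ?_)
  · rw [norm_mul]
    exact mul_le_mul (hA i k) (hB k j) (norm_nonneg _) ha
  · simp

theorem tensorId_unitaryChannel_apply (U : Matrix.unitaryGroup (Fin d) ℂ)
    (ρ : Matrix (Fin d × Fin d) (Fin d × Fin d) ℂ) (p q : Fin d × Fin d) :
    tensorId (unitaryChannel U) ρ p q =
      (U.1 * (Matrix.of (fun i j => ρ (i, p.2) (j, q.2)) * star U.1)) p.1 q.1 :=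
  rfl

theorem norm_tensorId_unitaryChannel_le (U : Matrix.unitaryGroup (Fin d) ℂ)
    {ρ : Matrix (Fin d × Fin d) (Fin d × Fin d) ℂ} (hρ : IsDensity ρ) (p q : Fin d × Fin d) :
    ‖tensorId (unitaryChannel U) ρ p q‖ ≤ d * (1 * (d * (1 * 1))) := by
  rw [tensorId_unitaryChannel_apply]
  refine norm_mul_entry_le zero_le_one (entry_norm_bound_of_unitary U.2) (fun i j => ?_) _ _
  exact norm_mul_entry_le zero_le_one (fun i j => hρ.norm_entry_le_one _ _)
    (entry_norm_bound_of_unitary (Unitary.star_mem U.2)) i j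

/-- A crude bound suffices: it only ensures that the real supremum in `diamondDist` is not the
default value `0` of an unbounded set. -/
theorem bddAbove_traceNorm_sub (U V : Matrix.unitaryGroup (Fin d) ℂ) :
    BddAbove (Set.range fun ρ : {ρ : Matrix (Fin d × Fin d) (Fin d × Fin d) ℂ // IsDensity ρ} =>
      traceNorm (tensorId (unitaryChannel U) ρ.1 - tensorId (unitaryChannel V) ρ.1)) := by
  refine ⟨_, Set.forall_mem_range.mpr fun ρ => traceNorm_le_of_entry_le
    (c := d * (1 * (d * (1 * 1))) + d * (1 * (d * (1 * 1)))) fun p q => ?_⟩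
  exact (norm_sub_le _ _).trans (add_le_add (norm_tensorId_unitaryChannel_le U ρ.2 p q)
    (norm_tensorId_unitaryChannel_le V ρ.2 p q))

theorem sum_norm_sq_mulVec (U : Matrix.unitaryGroup (Fin d) ℂ) (ψ : Fin d → ℂ) :
    ∑ i, ‖U.1.mulVec ψ i‖ ^ 2 = ∑ i, ‖ψ i‖ ^ 2 := by
  have key : ∀ v : Fin d → ℂ, ((∑ i, ‖v i‖ ^ 2 : ℝ) : ℂ) = star v ⬝ᵥ v := fun v => by
    rw [Complex.ofReal_sum, dotProduct]
    refine Finset.sum_congr rfl fun i _ => ?_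
    rw [Complex.ofReal_pow]
    exact (Complex.conj_mul' _).symm
  rw [← Complex.ofReal_inj, key, key, Matrix.star_mulVec, ← Matrix.dotProduct_mulVec,
    Matrix.mulVec_mulVec, ← Matrix.star_eq_conjTranspose, Matrix.UnitaryGroup.star_mul_self,
    Matrix.one_mulVec]

/-- The Hilbert-Schmidt distance of two pure states. -/
theorem sum_norm_sq_vecMulVec_sub {x y : Fin d → ℂ} (hx : ∑ i, ‖x i‖ ^ 2 = 1)
    (hy : ∑ i, ‖y i‖ ^ 2 = 1) :
    ∑ i, ∑ j, ‖x i * star (x j) - y i * star (y j)‖ ^ 2 =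
      2 - 2 * ‖∑ i, star (x i) * y i‖ ^ 2 := by
  have h1 : ∀ i j, ‖x i * star (x j) - y i * star (y j)‖ ^ 2 =
      ‖x i‖ ^ 2 * ‖x j‖ ^ 2 + ‖y i‖ ^ 2 * ‖y j‖ ^ 2 -
        2 * ((star (x i) * y i) * star (star (x j) * y j)).re := by
    intro i j
    rw [Complex.sq_norm, Complex.normSq_sub, ← Complex.sq_norm, ← Complex.sq_norm, norm_mul,
      norm_mul, norm_star, norm_star, mul_pow, mul_pow]
    congr 2
    rw [← Complex.conj_re]
    congr 1
    simp only [map_mul, Complex.conj_conj, ← starRingEnd_apply]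
    ring
  simp only [h1, Finset.sum_sub_distrib, Finset.sum_add_distrib, ← Finset.mul_sum,
    ← Finset.sum_mul, ← Complex.re_sum, ← star_sum, hx, hy]
  rw [← starRingEnd_apply, Complex.mul_conj', ← Complex.ofReal_pow, Complex.ofReal_re]
  norm_num

/-- Unitary channels at a small diamond distance map every pure state to states of large
fidelity. -/
theorem one_half_le_of_diamondDist_lt_one (hd : 0 < d) {U V : Matrix.unitaryGroup (Fin d) ℂ}
    (h : diamondDist (unitaryChannel U) (unitaryChannel V) < 1) {ψ : Fin d → ℂ}
    (hψ : ∑ i, ‖ψ i‖ ^ 2 = 1) :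
    1 / 2 ≤ ‖∑ i, star (U.1.mulVec ψ i) * V.1.mulVec ψ i‖ ^ 2 := by
  let z : Fin d := ⟨0, hd⟩
  -- The test state is `ψ` tensored with a fixed basis vector of the ancilla; no entanglement is
  -- needed.
  let Φ : Fin d × Fin d → ℂ := fun p => if p.2 = z then ψ p.1 else 0
  have hΦ : ∑ p, ‖Φ p‖ ^ 2 = 1 := by
    rw [Fintype.sum_prod_type, ← hψ]
    refine Finset.sum_congr rfl fun i _ => ?_
    rw [Finset.sum_eq_single z (fun b _ hb => by simp [Φ, hb]) (by simp)]
    simp [Φ]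
  let ρ : Matrix (Fin d × Fin d) (Fin d × Fin d) ℂ := Matrix.vecMulVec Φ (star Φ)
  have hρ : IsDensity ρ := by
    refine ⟨Matrix.posSemidef_vecMulVec_self_star Φ, ?_⟩
    rw [Matrix.trace, ← Complex.ofReal_one, ← hΦ, Complex.ofReal_sum]
    refine Finset.sum_congr rfl fun p _ => ?_
    rw [Complex.ofReal_pow]
    exact Complex.mul_conj' _
  have hW : ∀ (W : Matrix.unitaryGroup (Fin d) ℂ) (i j : Fin d),
      tensorId (unitaryChannel W) ρ (i, z) (j, z) =
        W.1.mulVec ψ i * star (W.1.mulVec ψ j) := by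
    intro W i j
    have : Matrix.of (fun i j => ρ (i, z) (j, z)) = Matrix.vecMulVec ψ (star ψ) := by
      ext i j
      simp [ρ, Φ, Matrix.vecMulVec_apply]
    rw [tensorId_unitaryChannel_apply]
    simp only [this]
    rw [Matrix.vecMulVec_mul, Matrix.mul_vecMulVec, Matrix.star_eq_conjTranspose,
      ← Matrix.star_mulVec]
    rfl
  have hle : traceNorm (tensorId (unitaryChannel U) ρ - tensorId (unitaryChannel V) ρ) < 1 :=
    (le_ciSup (bddAbove_traceNorm_sub U V) ⟨ρ, hρ⟩).trans_lt h
  have hsq := (sum_norm_sq_le_traceNorm_sq _).trans_lt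
    (pow_lt_one₀ (traceNorm_nonneg _) hle two_ne_zero)
  -- Only the block at the ancilla index `z` is kept; there the entries are those of the difference
  -- of the two pure output states.
  have hsub : ∑ i, ∑ j, ‖(tensorId (unitaryChannel U) ρ - tensorId (unitaryChannel V) ρ)
      (i, z) (j, z)‖ ^ 2 ≤ ∑ p, ∑ q,
        ‖(tensorId (unitaryChannel U) ρ - tensorId (unitaryChannel V) ρ) p q‖ ^ 2 := by
    rw [Fintype.sum_prod_type]
    refine Finset.sum_le_sum fun i _ => ?_
    refine le_trans ?_ (Finset.single_le_sum
      (f := fun b => ∑ q, ‖(tensorId (unitaryChannel U) ρ - tensorId (unitaryChannel V) ρ)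
        (i, b) q‖ ^ 2)
      (fun b _ => Finset.sum_nonneg fun q _ => sq_nonneg _) (Finset.mem_univ z))
    rw [Fintype.sum_prod_type]
    exact Finset.sum_le_sum fun j _ => Finset.single_le_sum
      (f := fun b => ‖(tensorId (unitaryChannel U) ρ - tensorId (unitaryChannel V) ρ)
        (i, z) (j, b)‖ ^ 2)
      (fun b _ => sq_nonneg _) (Finset.mem_univ z)
  simp only [Matrix.sub_apply, hW] at hsub hsq
  rw [sum_norm_sq_vecMulVec_sub ((sum_norm_sq_mulVec U ψ).trans hψ)
    ((sum_norm_sq_mulVec V ψ).trans hψ)] at hsub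
  linarith

theorem sum_norm_sq_stateOf (hd : 0 < d) (V : Matrix.unitaryGroup (Fin d) ℂ) :
    ∑ i, ‖stateOf hd V i‖ ^ 2 = 1 := by
  have h : stateOf hd V = V.1.mulVec (Pi.single ⟨0, hd⟩ 1) := by
    rw [Matrix.mulVec_single_one]
    rfl
  rw [h, sum_norm_sq_mulVec, Finset.sum_eq_single ⟨0, hd⟩]
  · simp
  · intro b _ hb
    simp [hb]
  · simp

end

/-! ## Uniqueness -/

instance (d : ℕ) : MeasureTheory.IsProbabilityMeasure (haarU d) :=
  ⟨MeasureTheory.Measure.haarMeasure_self⟩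

open Classical in
/-- The pairs of keys that are equal or have channels at diamond distance less
than `δ`. -/
def closePairs (F : KeyedUnitaryFamily) (l : ℕ) (δ : ℝ) : Finset (F.Key l × F.Key l) :=
  {p | p.1 = p.2 ∨ diamondDist (unitaryChannel (F.U l p.1)) (unitaryChannel (F.U l p.2)) < δ}

/-- As the diagonal counts as close, the far pairs are exactly the complement; conditioning on
distinct keys only shrinks the denominator from `N²` to `N² - N`. -/
theorem one_sub_closePairs_le_farProb (F : KeyedUnitaryFamily) (l : ℕ) (δ : ℝ) :
    1 - ((closePairs F l δ).card : ℝ) / (Fintype.card (F.Key l) : ℝ) ^ 2 ≤ farProb F l δ := by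
  classical
  set N := Fintype.card (F.Key l)
  have hN : 0 < N := Fintype.card_pos
  have hfar : {p : F.Key l × F.Key l | p.1 ≠ p.2 ∧
      δ ≤ diamondDist (unitaryChannel (F.U l p.1)) (unitaryChannel (F.U l p.2))} =
      ((closePairs F l δ)ᶜ : Finset _) := by
    ext p
    simp [closePairs]
  have hdist : {p : F.Key l × F.Key l | p.1 ≠ p.2} =
      ((Finset.univ : Finset (F.Key l)).offDiag : Finset _) := by
    ext p
    simp
  have hdiag : N ≤ (closePairs F l δ).card := by
    rw [show N = (Finset.univ : Finset (F.Key l)).card from rfl, ← Finset.diag_card]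
    refine Finset.card_le_card fun p hp => ?_
    simp only [Finset.mem_diag] at hp
    simp [closePairs, hp.2]
  rw [farProb, hfar, hdist, Set.ncard_coe_finset, Set.ncard_coe_finset, Finset.offDiag_card,
    Finset.card_univ]
  have hc : ((closePairs F l δ)ᶜ.card : ℝ) = (N : ℝ) ^ 2 - (closePairs F l δ).card := by
    rw [Finset.card_compl, Nat.cast_sub (Finset.card_le_univ _), Fintype.card_prod, Nat.cast_mul,
      sq]
  have hD : ((N * N - N : ℕ) : ℝ) = (N : ℝ) ^ 2 - N := by
    rw [Nat.cast_sub (Nat.le_mul_self N), Nat.cast_mul, sq]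
  have hN' : (0 : ℝ) < N := Nat.cast_pos.mpr hN
  have hdiag' : (N : ℝ) ≤ (closePairs F l δ).card := Nat.cast_le.mpr hdiag
  rw [one_sub_div (by positivity), ← hc]
  change _ ≤ _ / ((N * N - N : ℕ) : ℝ)
  -- With a single key the quotient is `0` by convention, and the left side is nonpositive because
  -- the diagonal is everything.
  rcases (Nat.zero_le (N * N - N)).eq_or_lt with h0 | h0
  · rw [← h0] at hD ⊢
    rw [Nat.cast_zero] at hD
    rw [Nat.cast_zero, div_zero, hc]
    exact div_nonpos_of_nonpos_of_nonneg (by linarith) (by positivity)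
  · refine div_le_div_of_nonneg_left (Nat.cast_nonneg _) (Nat.cast_pos.mpr h0) ?_
    rw [hD]
    linarith

/-- The factor `1/4` is the fidelity bound `1/2` times the `1/2` of `overlap_ge`. The estimate holds
for every unit challenge, so it passes through the Haar average. -/
theorem closePairs_le_forgeProb (F : KeyedUnitaryFamily) (Q : QPTAlgorithm F)
    (hQ : ∀ l, (Q.circuit l).QueryFree) {ε : ℕ → ℝ}
    (hε : ∀ (l : ℕ) (k : F.Key l) (ψ : Fin (F.d l) → ℂ), ∑ j, ‖ψ j‖ ^ 2 = 1 →
      1 - ε l ≤ overlap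
        ((Q.circuit l).run (1 : Matrix (Fin (F.d l)) (Fin (F.d l)) ℂ)
          (loadState (keyBasis k) (F.keyLen l) ψ))
        (F.keyLen l) ((F.U l k).1.mulVec ψ)) (l : ℕ) :
    1 / 4 * (((closePairs F l 1).card : ℝ) / (Fintype.card (F.Key l) : ℝ) ^ 2) - 2 * ε l ≤
      F.keyAvg l fun k => ∫ V, forgeProb ((idleAlgorithm F).circuit l) ((forger Q).circuit l)
        (F.U l k).1 (stateOf (F.d_pos l) V) ∂(haarU (F.d l)) := by
  classical
  set N : ℝ := (Fintype.card (F.Key l) : ℝ)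
  have hN : N = 2 ^ F.keyLen l := by simp [N, KeyedUnitaryFamily.Key]
  have hN0 : 0 < N := by rw [hN]; positivity
  let χ : F.Key l → F.Key l → ℝ := fun k j => if (k, j) ∈ closePairs F l 1 then 1 else 0
  have hpair : ∀ (k j : F.Key l) (ψ : Fin (F.d l) → ℂ), ∑ i, ‖ψ i‖ ^ 2 = 1 →
      1 / 4 * χ k j - 2 * ε l ≤ overlap ((Q.circuit l).run (1 : Matrix (Fin (F.d l)) (Fin (F.d l)) ℂ)
        (loadState (keyBasis j) (F.keyLen l) ψ)) (F.keyLen l) ((F.U l k).1.mulVec ψ) := by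
    intro k j ψ hψ
    have ha := (sum_norm_sq_mulVec (F.U l k) ψ).trans hψ
    have hb := (sum_norm_sq_mulVec (F.U l j) ψ).trans hψ
    refine le_trans ?_ (overlap_ge ?_ (F.keyLen l) ha hb (hε l j ψ hψ))
    · have : 1 / 2 * χ k j ≤
          ‖∑ i, star ((F.U l k).1.mulVec ψ i) * (F.U l j).1.mulVec ψ i‖ ^ 2 := by
        by_cases h : (k, j) ∈ closePairs F l 1
        · simp only [χ, if_pos h, mul_one]
          simp only [closePairs, Finset.mem_filter, Finset.mem_univ, true_and] at h
          rcases h with rfl | h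
          · have : ∑ i, star ((F.U l k).1.mulVec ψ i) * (F.U l k).1.mulVec ψ i = 1 := by
              rw [← inner_toLp, inner_self_eq_norm_sq_to_K, norm_toLp_eq_one ha]
              norm_num
            rw [this]
            norm_num
          · exact one_half_le_of_diamondDist_lt_one (F.d_pos l) h hψ
        · simp only [χ, if_neg h, mul_zero]
          exact sq_nonneg _
      linarith
    · rw [normSq_run _ (hQ l), normSq_loadState, hψ]
  have hkey : ∀ k : F.Key l, (∑ j, (1 / 4 * χ k j - 2 * ε l)) / N ≤
      ∫ V, forgeProb ((idleAlgorithm F).circuit l) ((forger Q).circuit l)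
        (F.U l k).1 (stateOf (F.d_pos l) V) ∂(haarU (F.d l)) := by
    intro k
    have hcont := continuous_forgeProb (F.d_pos l) ((idleAlgorithm F).circuit l)
      ((forger Q).circuit l) (F.U l k).1
    have hint := hcont.integrable_of_hasCompactSupport (μ := haarU (F.d l))
      (HasCompactSupport.of_compactSpace _)
    have hconst : ∫ _V, (∑ j, (1 / 4 * χ k j - 2 * ε l)) / N ∂(haarU (F.d l)) =
        (∑ j, (1 / 4 * χ k j - 2 * ε l)) / N := by
      rw [MeasureTheory.integral_const, MeasureTheory.probReal_univ, one_smul]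
    rw [← hconst]
    refine MeasureTheory.integral_mono (MeasureTheory.integrable_const _) hint fun V => ?_
    have hV := sum_norm_sq_stateOf (F.d_pos l) V
    refine le_trans ?_ (sum_overlap_le_overlap_run_forgeCircuit (m := F.keyLen l)
      (1 : Matrix (Fin (F.d l)) (Fin (F.d l)) ℂ) (hQ l) (stateOf (F.d_pos l) V)
      ((F.U l k).1.mulVec (stateOf (F.d_pos l) V)))
    rw [← hN]
    exact div_le_div_of_nonneg_right (Finset.sum_le_sum fun j _ => hpair k j _ hV) hN0.le
  refine le_trans (le_of_eq ?_)
    (div_le_div_of_nonneg_right (Finset.sum_le_sum fun k _ => hkey k) hN0.le)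
  change _ = _ / N
  have hcount : ∑ k, ∑ j, χ k j = ((closePairs F l 1).card : ℝ) := by
    rw [← Fintype.sum_prod_type' χ]
    simp [χ]
  have hcard : ((Finset.univ : Finset (F.Key l)).card : ℝ) = N := rfl
  simp only [Finset.sum_sub_distrib, ← Finset.mul_sum, ← Finset.sum_div, Finset.sum_const,
    nsmul_eq_mul, hcount, hcard]
  field_simp

end QPR

end

theorem mainTheorem3 (F : QPR.KeyedUnitaryFamily) (hPRU : QPR.IsPRU F)
    (hUnf : QPR.UniversallyUnforgeable F) :
    ∃ δ : ℕ → ℝ, QPR.NonNegligible δ ∧ QPR.Uniqueness F δ := by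
  obtain ⟨Q, hQ, ε, hε, hQε⟩ := hPRU.1
  have hforge := hUnf (QPR.idleAlgorithm F) (QPR.forger Q)
    fun l => (hQ l).forgeCircuit (QPR.numQubits (F.d l)) (F.keyLen l)
  -- Solving the bound of `closePairs_le_forgeProb` for the fraction of close pairs gives four times
  -- the forging probability plus `8 * ε`.
  refine ⟨fun _ => 1, ⟨0, Filter.Eventually.of_forall fun l => by simp⟩, _,
    (hforge.const_mul 4).add (hε.const_mul 8), fun l => ?_⟩
  have h1 := QPR.closePairs_le_forgeProb F Q hQ hQε l
  have h2 := QPR.one_sub_closePairs_le_farProb F l 1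
  simp only [Pi.add_apply]
  linarith
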